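/- \textbf{Theorem 3 (thm:ranking).} Let $\Theta=[0,1]$ and let $P$ be a probability measure on $\Theta^2$ (the reference belief) which has a positive density with respect to Lebesgue measure and is IID, i.e. it is the product of two equal marginals. Let $F$ be the marginal distribution function of $P$ and $f=F'$ (a version of) its marginal density. For a probability measure $Q\ll P$ on $\Theta^2$, a \emph{rearrangement} of $Q$ is a probability measure $Q'\ll P$ with $P\{dQ'/dP\le c\}=P\{dQ/dP\le c\}$ for all $c\ge 0$. Let $\mathcal S$ be one of: the set of all probability measures $Q\ll P$ on $\Theta^2$; the set of those $Q\ll P$ that are products of their marginals; the set of those $Q\ll P$ that are products of two equal marginals. Let $\mathcal Q\subset\mathcal S$ be a set of priors with $P\in\mathcal Q$ that is rearrangement invariant relative to $\mathcal S$: every rearrangement in $\mathcal S$ of an element of $\mathcal Q$ belongs to $\mathcal Q$. For an auction in which bidder $i\in\{1,2\}$ pays $t_i(\theta,\theta')\ge 0$ when her own type is $\theta$ and her competitor's type is $\theta'$, let the worst-case revenue be $$\mathcal R(t)=\inf_{Q\in\mathcal Q}\iint_{\Theta^2}\bigl[t_1(\theta,\theta')+t_2(\theta',\theta)\bigr]\,Q(d\theta,d\theta')$$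 (a minimum whenever it is attained, for instance when $\mathcal Q$ is weakly compact). Let the bidders be ambiguity neutral, i.e. they believe that types are drawn according to $P$, so that the equilibrium bids and payments in the first-price auction (I), the second-price auction (II), the all-pay auction (A) and the war of attrition (W) are, for $i=1,2$, $$\begin{array}{ll} b^{I}(\theta)=\theta-\int_0^\theta \frac{F(z)}{F(\theta)}\,dz, & t^{I}_i(\theta,\theta')=b^{I}(\theta)\bigl(\mathbf 1[\theta>\theta']+\tfrac12\mathbf 1[\theta=\theta']\bigr),\\ b^{II}(\theta)=\theta, & t^{II}_i(\theta,\theta')=b^{II}(\theta')\bigl(\mathbf 1[\theta>\theta']+\tfrac12\mathbf 1[\theta=\theta']\bigr),\\ b^{A}(\theta)=\theta F(\theta)-\int_0^\theta F(z)\,dz, & t^{A}_i(\theta,\theta')=b^{A}(\theta),\\ b^{W}(\theta)=\int_0^\theta \frac{z f(z)}{1-F(z)}\,dz\in[0,\infty], & t^{W}_i(\theta,\theta')=b^{W}(\theta')\mathbf 1[\theta>\theta']+b^{W}(\theta)\mathbf 1[\theta\le\theta'].\end{array}$$ Then: (i) $\mathcal R(t^{I})\ge\mathcal R(t^{II})$;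 (ii) $\mathcal R(t^{I})\ge\mathcal R(t^{A})$; (iii) $\mathcal R(t^{A})\ge\mathcal R(t^{W})$; (iv) if moreover $\theta f(\theta)/[1-F(\theta)]$ is non-decreasing in $\theta\in[0,1)$, then $\mathcal R(t^{II})\ge\mathcal R(t^{W})$. -/

import Mathlib

open MeasureTheory Set
open scoped ENNReal NNReal

namespace WorstCaseAuction

noncomputable section

/-- The type space `[0, 1]` of a bidder, with its order, Borel sets and Lebesgue measure `volume`. -/
abbrev Typ : Type := unitInterval

/-! ### Beliefs and rearrangements on a general probability space -/

/-- `Δ(Ω, μ)`: the probability measures on `Ω` that are absolutely continuous with respect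
to `μ`. -/
def beliefs {Ω : Type*} [MeasurableSpace Ω] (μ : Measure Ω) : Set (Measure Ω) :=
  {ν | IsProbabilityMeasure ν ∧ ν ≪ μ}

/-- `ν'` is a rearrangement of `ν` with respect to `μ`: the densities `dν'/dμ` and `dν/dμ` have the
same distribution under `μ`. -/
def IsRearrangement {Ω : Type*} [MeasurableSpace Ω] (μ ν' ν : Measure Ω) : Prop :=
  ∀ c : ℝ≥0, μ {ω | ν'.rnDeriv μ ω ≤ (c : ℝ≥0∞)} = μ {ω | ν.rnDeriv μ ω ≤ (c : ℝ≥0∞)}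

/-- `𝒬 ⊆ 𝒮` is rearrangement invariant relative to `𝒮` with respect to `μ`. -/
def RearrangementInvariant {Ω : Type*} [MeasurableSpace Ω] (μ : Measure Ω)
    (𝒮 𝒬 : Set (Measure Ω)) : Prop :=
  𝒬 ⊆ 𝒮 ∧ ∀ ν ∈ 𝒬, ∀ ν' ∈ 𝒮, IsRearrangement μ ν' ν → ν' ∈ 𝒬

/-! ### Beliefs about the type profile -/

/-- A joint belief is independent if it is the product of its marginals. -/
def IsIndependent (Q : Measure (Typ × Typ)) : Prop :=
  Q = Q.fst.prod Q.snd

/-- A joint belief is IID if it is the product of its marginals and these coincide. -/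
def IsIID (Q : Measure (Typ × Typ)) : Prop :=
  IsIndependent Q ∧ Q.fst = Q.snd

/-- `Δ^Ind(Θ², P)`. -/
def independentBeliefs (P : Measure (Typ × Typ)) : Set (Measure (Typ × Typ)) :=
  {Q | Q ∈ beliefs P ∧ IsIndependent Q}

/-- `Δ^IID(Θ², P)`. -/
def iidBeliefs (P : Measure (Typ × Typ)) : Set (Measure (Typ × Typ)) :=
  {Q | Q ∈ beliefs P ∧ IsIID Q}

/-- `P` has a positive density with respect to Lebesgue measure on `[0, 1]²`. -/
def HasPositiveDensity (P : Measure (Typ × Typ)) : Prop :=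
  ∃ p : Typ × Typ → ℝ≥0∞, Measurable p ∧ (∀ x, 0 < p x) ∧
    P = (volume : Measure (Typ × Typ)).withDensity p

/-- The marginal cumulative distribution function `F` of `P`. -/
def margCDF (P : Measure (Typ × Typ)) (z : Typ) : ℝ :=
  P.real {x | x.1 ≤ z}

/-- `f` is (a version of) the marginal density of `P` with respect to Lebesgue measure on
`[0, 1]`. -/
structure IsMargDensity (P : Measure (Typ × Typ)) (f : Typ → ℝ) : Prop where
  measurable : Measurable f
  nonneg : ∀ θ, 0 ≤ f θ
  fst_eq : P.fst = (volume : Measure Typ).withDensity fun θ => ENNReal.ofReal (f θ)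

/-! ### Transfers and worst-case revenue -/

/-- A transfer function: `t i θ θ'` is the payment of bidder `i` when her own type is `θ` and
her competitor's type is `θ'`. Payments are nonnegative; `∞` is allowed only because the bid of
the highest type in the war of attrition is infinite. -/
abbrev Transfer : Type := Fin 2 → Typ → Typ → ℝ≥0∞

/-- Expected revenue of an auction under the belief `Q` about (type of bidder 1, type of
bidder 2). -/
def expectedRevenue (Q : Measure (Typ × Typ)) (t : Transfer) : ℝ≥0∞ :=
  ∫⁻ x, (t 0 x.1 x.2 + t 1 x.2 x.1) ∂Q

/-- Worst-case revenue over the set of priors `𝒬`; it is the minimum expected revenue whenever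
the minimum exists. -/
def worstCaseRevenue (𝒬 : Set (Measure (Typ × Typ))) (t : Transfer) : ℝ≥0∞ :=
  ⨅ Q ∈ 𝒬, expectedRevenue Q t

/-! ### The four auctions -/

/-- First-price bid: `θ - ∫₀^θ F(z) / F(θ) dz`, a nonnegative number. -/
def bidI (P : Measure (Typ × Typ)) (θ : Typ) : ℝ≥0∞ :=
  ENNReal.ofReal ((θ : ℝ) - ∫ z in Iic θ, margCDF P z / margCDF P θ)

/-- Second-price bid: the type itself. -/
def bidII (θ : Typ) : ℝ≥0∞ :=
  ENNReal.ofReal (θ : ℝ)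

/-- All-pay bid: `θ F(θ) - ∫₀^θ F(z) dz`, a nonnegative number. -/
def bidA (P : Measure (Typ × Typ)) (θ : Typ) : ℝ≥0∞ :=
  ENNReal.ofReal ((θ : ℝ) * margCDF P θ - ∫ z in Iic θ, margCDF P z)

/-- War-of-attrition bid: `∫₀^θ z f(z) / (1 - F(z)) dz`. -/
def bidW (P : Measure (Typ × Typ)) (f : Typ → ℝ) (θ : Typ) : ℝ≥0∞ :=
  ∫⁻ z in Iic θ, ENNReal.ofReal ((z : ℝ) * f z / (1 - margCDF P z))

/-- First-price auction: the winner pays her own bid, ties are broken by a fair coin. -/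
def transferI (P : Measure (Typ × Typ)) : Transfer := fun _ θ θ' =>
  if θ' < θ then bidI P θ else if θ = θ' then bidI P θ / 2 else 0

/-- Second-price auction: the winner pays the competitor's bid, ties are broken by a fair coin. -/
def transferII : Transfer := fun _ θ θ' =>
  if θ' < θ then bidII θ' else if θ = θ' then bidII θ' / 2 else 0

/-- All-pay auction: every bidder pays her own bid. -/
def transferA (P : Measure (Typ × Typ)) : Transfer := fun _ θ _ => bidA P θ

/-- War of attrition: both bidders pay the lower bid. -/
def transferW (P : Measure (Typ × Typ)) (f : Typ → ℝ) : Transfer := fun _ θ θ' =>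
  if θ' < θ then bidW P f θ' else bidW P f θ

end

end WorstCaseAuction

namespace WorstCaseAuction

noncomputable section

/-! ### Chebyshev's integral inequality for lower integrals -/

/-! Each comparison `t ≤ t'` rests on two steps. First, the revenue `X` of the better auction `t'`
increases in both types. Take a prior in `𝒬` and rearrange its density so that it decreases along a
score `S` that orders profiles as `X` does and has an atomless law. The rearranged prior stays in
`𝒬`, its density is antitone in both types, and by the bathtub principle the expectation of `X` does
not rise. When priors must be independent or IID, the marginal densities are rearranged separately
and monotonicity of `X` is used one coordinate at a time. This is `exists_antitone_prior`. It
therefore suffices to show that `t` earns at most as much as `t'` under every antitone density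
(`worstCaseRevenue_le_of_forall_antitone`).

Second, under the reference belief the interim payments of a fixed own type agree across the
auctions (revenue equivalence), and an antitone density on the competitor's type tilts these
equalities in a known direction. Chebyshev's inequality gives I over II, because the second price
rises with the competitor's type while the first price is its conditional mean. It also gives A over
W, because the war-of-attrition payment rises with the competitor's type and has the all-pay bid as
its mean. I beats A because an antitone density makes winning more likely.

II against W has no such interim argument. Both revenues depend only on the lower type, with equal
expectation under the reference belief. The monotonicity assumption in (iv) makes `2 * bidW` cross
the identity at most once, from below. The mass that an antitone density puts on the lower type,
relative to the reference belief, is decreasing, so it favours the function that is larger first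
(`lintegral_mul_le_of_crossing`). -/

/-- The expansion of `(b - a) * (d - c) ≥ 0` without subtraction, so that infinite values are
allowed. -/
theorem ennreal_mul_add_mul_le {a b c d : ℝ≥0∞} (hab : a ≤ b) (hcd : c ≤ d) :
    a * d + b * c ≤ a * c + b * d := by
  obtain ⟨e, rfl⟩ := exists_add_of_le hab
  obtain ⟨g, rfl⟩ := exists_add_of_le hcd
  have : a * c + (a + e) * (c + g) = a * (c + g) + (a + e) * c + e * g := by ring
  rw [this]
  exact le_self_add

theorem ennreal_le_of_add_self_le {a b : ℝ≥0∞} (h : a + a ≤ b + b) : a ≤ b := by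
  rw [← two_mul, ← two_mul] at h
  exact (ENNReal.mul_le_mul_iff_right (by simp) (by simp)).1 h

/-- Chebyshev's inequality: an antitone and a monotone function are negatively correlated. -/
theorem measure_univ_mul_lintegral_mul_le {α : Type*} [MeasurableSpace α] [LinearOrder α]
    (ν : Measure α) {q h : α → ℝ≥0∞} (hqm : Measurable q) (hhm : Measurable h)
    (hq : Antitone q) (hh : Monotone h) :
    ν univ * ∫⁻ x, q x * h x ∂ν ≤ (∫⁻ x, q x ∂ν) * ∫⁻ x, h x ∂ν := by
  have hqh : Measurable fun x => q x * h x := hqm.mul hhm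
  -- Symmetrization: doubling turns the claim into the double integral of `(q x - q y) * (h x - h y)
  -- ≤ 0`, rearranged to avoid differences.
  apply ennreal_le_of_add_self_le
  calc ν univ * ∫⁻ x, q x * h x ∂ν + ν univ * ∫⁻ x, q x * h x ∂ν
      = ∫⁻ x, ∫⁻ y, (q x * h x + q y * h y) ∂ν ∂ν := by
        have : ∀ x, ∫⁻ y, (q x * h x + q y * h y) ∂ν
            = q x * h x * ν univ + ∫⁻ y, q y * h y ∂ν := fun x => by
          rw [lintegral_add_left measurable_const, lintegral_const]
        simp_rw [this]
        rw [lintegral_add_right _ measurable_const, lintegral_const,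
          lintegral_mul_const _ hqh]
        ring
    _ ≤ ∫⁻ x, ∫⁻ y, (q x * h y + h x * q y) ∂ν ∂ν := by
        refine lintegral_mono fun x => lintegral_mono fun y => ?_
        rcases le_total x y with hxy | hxy
        · have := ennreal_mul_add_mul_le (hq hxy) (hh hxy)
          calc q x * h x + q y * h y = q y * h y + q x * h x := add_comm _ _
            _ ≤ q y * h x + q x * h y := this
            _ = _ := by ring
        · have := ennreal_mul_add_mul_le (hq hxy) (hh hxy)
          calc q x * h x + q y * h y ≤ q x * h y + q y * h x := this
            _ = _ := by ring
    _ = _ := by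
        have : ∀ x, ∫⁻ y, (q x * h y + h x * q y) ∂ν
            = q x * (∫⁻ y, h y ∂ν) + h x * ∫⁻ y, q y ∂ν := fun x => by
          rw [lintegral_add_left (hhm.const_mul _), lintegral_const_mul _ hhm,
            lintegral_const_mul _ hqm]
        simp_rw [this]
        rw [lintegral_add_left (hqm.mul_const _), lintegral_mul_const _ hqm,
          lintegral_mul_const _ hhm]
        ring

/-! ### The probability integral transform -/

/-- The jump of the distribution function at a point is the mass of that point. -/
theorem continuous_cdf_of_nullSingleton (ν : Measure ℝ) [IsProbabilityMeasure ν]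
    [NullSingletonClass ν] : Continuous (ProbabilityTheory.cdf ν) := by
  refine continuous_iff_continuousAt.2 fun a => ?_
  rw [(ProbabilityTheory.monotone_cdf ν).continuousAt_iff_leftLim_eq_rightLim,
    StieltjesFunction.rightLim_eq]
  have h : (ProbabilityTheory.cdf ν).measure {a} = 0 := by
    rw [ProbabilityTheory.measure_cdf]; exact measure_singleton a
  rw [StieltjesFunction.measure_singleton, ENNReal.ofReal_eq_zero, sub_nonpos] at h
  exact le_antisymm ((ProbabilityTheory.monotone_cdf ν).leftLim_le le_rfl) h

theorem exists_measure_Iic_eq (ν : Measure ℝ) [IsProbabilityMeasure ν]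
    [NullSingletonClass ν] {p : ℝ≥0∞} (h0 : 0 < p) (h1 : p < 1) : ∃ a, ν (Iic a) = p := by
  have hp : p ≠ ∞ := (h1.trans ENNReal.one_lt_top).ne
  have hp0 : 0 < p.toReal := ENNReal.toReal_pos h0.ne' hp
  have hp1 : p.toReal < 1 := by
    rw [← ENNReal.toReal_one]; exact (ENNReal.toReal_lt_toReal hp (by simp)).2 h1
  obtain ⟨x, hx⟩ := ((ProbabilityTheory.tendsto_cdf_atBot ν).eventually_lt_const hp0).exists
  obtain ⟨y, hy⟩ := ((ProbabilityTheory.tendsto_cdf_atTop ν).eventually_const_lt hp1).exists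
  obtain ⟨a, ha⟩ := mem_range_of_exists_le_of_exists_ge (continuous_cdf_of_nullSingleton ν)
    ⟨x, hx.le⟩ ⟨y, hy.le⟩
  exact ⟨a, by rw [← ProbabilityTheory.ofReal_cdf, ha, ENNReal.ofReal_toReal hp]⟩

/-- An atomless variable composed with its own distribution function is uniform. Levels of the
distribution function are attained by continuity; for the lower bound, levels `r < p` are attained
and then `r` tends to `p`. -/
theorem measure_setOf_measure_Iic_lt (ν : Measure ℝ) [IsProbabilityMeasure ν]
    [NullSingletonClass ν] {p : ℝ≥0∞} (h1 : p ≤ 1) : ν {s | ν (Iic s) < p} = p := by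
  apply le_antisymm
  · rcases h1.eq_or_lt with rfl | h1
    · exact prob_le_one
    rcases eq_or_ne p 0 with rfl | h0
    · simp
    obtain ⟨a, ha⟩ := exists_measure_Iic_eq ν (pos_iff_ne_zero.2 h0) h1
    rw [← ha]
    refine measure_mono fun s hs => ?_
    by_contra hsa
    exact absurd hs (not_lt.2 (measure_mono (Iic_subset_Iic.2 (not_le.1 hsa).le)))
  · refine le_of_forall_lt_imp_le_of_dense fun r hr => ?_
    rcases eq_or_ne r 0 with rfl | h0
    · exact zero_le
    obtain ⟨b, hb⟩ := exists_measure_Iic_eq ν (pos_iff_ne_zero.2 h0) (hr.trans_le h1)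
    rw [← hb]
    refine measure_mono fun s hs => ?_
    exact (measure_mono (Iic_subset_Iic.2 hs)).trans_lt (hb ▸ hr)

/-! ### Decreasing rearrangements and the bathtub principle -/

section Rearrangement

variable {Ω : Type*} [MeasurableSpace Ω]

/-- The decreasing rearrangement of `q`, as a function of the upper-tail probability. -/
def quantile (P : Measure Ω) (q : Ω → ℝ≥0∞) (p : ℝ≥0∞) : ℝ≥0∞ :=
  sInf {c | P {ω | c < q ω} ≤ p}

theorem quantile_antitone (P : Measure Ω) (q : Ω → ℝ≥0∞) : Antitone (quantile P q) :=
  fun _ _ h => sInf_le_sInf fun _ hc => le_trans hc h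

/-- The infimum defining the quantile is attained, since tail probabilities are right-continuous:
`{c < q}` is covered by the increasing union of `{u n < q}` for `u n` decreasing to the infimum. -/
theorem quantile_le_iff (P : Measure Ω) (q : Ω → ℝ≥0∞) (p c : ℝ≥0∞) :
    quantile P q p ≤ c ↔ P {ω | c < q ω} ≤ p := by
  refine ⟨fun h => ?_, fun h => sInf_le h⟩
  have hne : {c | P {ω | c < q ω} ≤ p}.Nonempty := ⟨⊤, by simp⟩
  obtain ⟨u, hu, hlim, hmem⟩ := exists_seq_tendsto_sInf hne (OrderBot.bddBelow _)
  have hsub : {ω | c < q ω} ⊆ ⋃ n, {ω | u n < q ω} := fun ω hω => by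
    obtain ⟨n, hn⟩ := (hlim.eventually_lt_const (lt_of_le_of_lt h hω)).exists
    exact mem_iUnion.2 ⟨n, hn⟩
  refine (measure_mono hsub).trans ?_
  have hmono : Monotone fun n => {ω | u n < q ω} :=
    fun m n hmn ω (hω : u m < q ω) => lt_of_le_of_lt (hu hmn) hω
  rw [hmono.measure_iUnion]
  exact iSup_le hmem

theorem exists_rearrangement (P : Measure Ω) [IsProbabilityMeasure P] {S : Ω → ℝ}
    (hS : Measurable S) (hS0 : ∀ c, P {ω | S ω = c} = 0) {q : Ω → ℝ≥0∞} (hq : Measurable q) :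
    ∃ q' : Ω → ℝ≥0∞, Measurable q' ∧ (∀ ω ω', S ω ≤ S ω' → q' ω' ≤ q' ω) ∧
      P.map q' = P.map q := by
  set ν := P.map S with hν
  have : IsProbabilityMeasure ν := Measure.isProbabilityMeasure_map hS.aemeasurable
  have : NullSingletonClass ν := ⟨fun c => by
    rw [hν, Measure.map_apply hS (measurableSet_singleton c)]; exact hS0 c⟩
  have hG : Monotone fun s => ν (Iic s) := fun s t h => measure_mono (Iic_subset_Iic.2 h)
  have hanti : Antitone fun s => quantile P q (ν (Iic s)) :=
    fun s t h => quantile_antitone P q (hG h)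
  have hm : Measurable fun ω => quantile P q (ν (Iic (S ω))) := hanti.measurable.comp hS
  -- The rank `ν (Iic (S ω))` is uniform, and the quantile function of `q` applied to a uniform
  -- variable has the law of `q`; high scores have high ranks, hence low density.
  refine ⟨fun ω => quantile P q (ν (Iic (S ω))), hm, fun ω ω' h => hanti h, ?_⟩
  have : IsProbabilityMeasure (P.map fun ω => quantile P q (ν (Iic (S ω)))) :=
    Measure.isProbabilityMeasure_map hm.aemeasurable
  have : IsProbabilityMeasure (P.map q) := Measure.isProbabilityMeasure_map hq.aemeasurable
  refine Measure.ext_of_Iic _ _ fun c => ?_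
  have key : (P.map fun ω => quantile P q (ν (Iic (S ω)))) (Ioi c) = P.map q (Ioi c) := by
    rw [Measure.map_apply hm measurableSet_Ioi, Measure.map_apply hq measurableSet_Ioi]
    have : (fun ω => quantile P q (ν (Iic (S ω)))) ⁻¹' Ioi c
        = S ⁻¹' {s | ν (Iic s) < P {ω | c < q ω}} := by
      ext ω
      simp only [mem_preimage, mem_Ioi, mem_ofPred_eq]
      rw [← not_le, quantile_le_iff, not_le]
    have hm' : MeasurableSet {s | ν (Iic s) < P {ω | c < q ω}} :=
      hG.measurable measurableSet_Iio
    rw [this, ← Measure.map_apply hS hm', ← hν, measure_setOf_measure_Iic_lt ν prob_le_one]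
    rfl
  rw [← compl_Ioi, prob_compl_eq_one_sub measurableSet_Ioi,
    prob_compl_eq_one_sub measurableSet_Ioi, key]

/-- The layer-cake formula for `q` under the measure with density `X`. It reduces the bathtub
principle to superlevel sets of `q`. -/
theorem lintegral_mul_eq_lintegral_setLIntegral (P : Measure Ω) {X q : Ω → ℝ≥0∞}
    (hX : Measurable X) (hq : Measurable q) (hfin : ∀ᵐ ω ∂P, q ω ≠ ∞) :
    ∫⁻ ω, X ω * q ω ∂P
      = ∫⁻ t in Ioi (0 : ℝ), ∫⁻ ω in {ω | ENNReal.ofReal t < q ω}, X ω ∂P := by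
  have hfin' : ∀ᵐ ω ∂(P.withDensity X), q ω ≠ ∞ :=
    (withDensity_absolutelyContinuous P X).ae_le hfin
  have h1 : ∫⁻ ω, X ω * q ω ∂P = ∫⁻ ω, q ω ∂(P.withDensity X) :=
    (lintegral_withDensity_eq_lintegral_mul P hX hq).symm
  have h2 : ∫⁻ ω, q ω ∂(P.withDensity X)
      = ∫⁻ ω, ENNReal.ofReal (q ω).toReal ∂(P.withDensity X) := by
    refine lintegral_congr_ae ?_
    filter_upwards [hfin'] with ω hω
    rw [ENNReal.ofReal_toReal hω]
  rw [h1, h2, lintegral_eq_lintegral_meas_lt _ (ae_of_all _ fun _ => ENNReal.toReal_nonneg)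
    hq.ennreal_toReal.aemeasurable]
  refine setLIntegral_congr_fun measurableSet_Ioi fun t ht => ?_
  have hset : MeasurableSet {ω | ENNReal.ofReal t < q ω} := hq measurableSet_Ioi
  rw [← withDensity_apply X hset]
  refine measure_congr ?_
  filter_upwards [hfin'] with ω hω
  refine propext ?_
  change t < (q ω).toReal ↔ ENNReal.ofReal t < q ω
  rw [ENNReal.ofReal_lt_iff_lt_toReal (le_of_lt ht) hω]

theorem setLIntegral_le_of_measure_eq (P : Measure Ω) [IsFiniteMeasure P] {X : Ω → ℝ≥0∞}
    {A B : Set Ω} (hA : MeasurableSet A) (hB : MeasurableSet B) (hAB : P A = P B)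
    (h : ∀ x ∈ A, ∀ y ∉ A, X x ≤ X y) : ∫⁻ ω in A, X ω ∂P ≤ ∫⁻ ω in B, X ω ∂P := by
  rw [← lintegral_inter_add_sdiff X A hB, ← lintegral_inter_add_sdiff X B hA, inter_comm B A]
  refine add_le_add le_rfl ?_
  have hd : P (A \ B) = P (B \ A) := by
    refine (ENNReal.add_left_inj (measure_ne_top P (A ∩ B))).1 ?_
    rw [measure_sdiff_add_inter A hB, inter_comm, measure_sdiff_add_inter B hA, hAB]
  -- The supremum of `X` over `A` is a level separating the values on `A` from those off `A`; the
  -- two differences have equal mass.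
  calc ∫⁻ ω in A \ B, X ω ∂P ≤ ∫⁻ _ in A \ B, (⨆ x ∈ A, X x) ∂P :=
        setLIntegral_mono' (hA.diff hB) fun ω hω => le_iSup₂ (f := fun x _ => X x) ω hω.1
    _ = ∫⁻ _ in B \ A, (⨆ x ∈ A, X x) ∂P := by
        rw [setLIntegral_const, setLIntegral_const, hd]
    _ ≤ ∫⁻ ω in B \ A, X ω ∂P :=
        setLIntegral_mono' (hB.diff hA) fun ω hω => iSup₂_le fun x hx => h x hx ω hω.2

/-- The bathtub principle: pairing `X` with the rearrangement of `q` that is decreasing in a score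
comonotone with `X` minimizes the integral. -/
theorem lintegral_mul_le_of_map_eq (P : Measure Ω) [IsProbabilityMeasure P] {S : Ω → ℝ}
    {q q' X : Ω → ℝ≥0∞} (hX : Measurable X) (hq : Measurable q) (hq' : Measurable q')
    (hfin : ∀ᵐ ω ∂P, q ω ≠ ∞) (hmap : P.map q' = P.map q)
    (hanti : ∀ ω ω', S ω ≤ S ω' → q' ω' ≤ q' ω) (hmono : ∀ ω ω', S ω < S ω' → X ω ≤ X ω') :
    ∫⁻ ω, X ω * q' ω ∂P ≤ ∫⁻ ω, X ω * q ω ∂P := by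
  have hfin' : ∀ᵐ ω ∂P, q' ω ≠ ∞ := by
    have htop : MeasurableSet {x : ℝ≥0∞ | x ≠ ∞} := (measurableSet_singleton _).compl
    rw [← ae_map_iff hq'.aemeasurable htop, hmap, ae_map_iff hq.aemeasurable htop]
    exact hfin
  rw [lintegral_mul_eq_lintegral_setLIntegral P hX hq hfin,
    lintegral_mul_eq_lintegral_setLIntegral P hX hq' hfin']
  refine lintegral_mono fun t => ?_
  refine setLIntegral_le_of_measure_eq P (hq' measurableSet_Ioi) (hq measurableSet_Ioi) ?_ ?_
  · have := congrArg (fun m => m (Ioi (ENNReal.ofReal t))) hmap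
    rwa [Measure.map_apply hq' measurableSet_Ioi, Measure.map_apply hq measurableSet_Ioi] at this
  · intro x hx y hy
    refine hmono x y (not_le.1 fun hyx => hy ?_)
    exact lt_of_lt_of_le hx (hanti y x hyx)

end Rearrangement

/-! ### The equilibrium bids as lower integrals -/

/-- The expected type on the event that the type is at most `θ`. -/
def lowerMoment (μ : Measure Typ) (θ : Typ) : ℝ≥0∞ :=
  ∫⁻ z in Iic θ, ENNReal.ofReal z ∂μ

theorem lowerMoment_monotone (μ : Measure Typ) : Monotone (lowerMoment μ) :=
  fun _ _ h => lintegral_mono_set (Iic_subset_Iic.2 h)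

theorem measurable_ofReal_coe : Measurable fun z : Typ => ENNReal.ofReal (z : ℝ) :=
  ENNReal.measurable_ofReal.comp measurable_subtype_coe

theorem monotone_ofReal_coe : Monotone fun z : Typ => ENNReal.ofReal (z : ℝ) :=
  fun _ _ h => ENNReal.ofReal_le_ofReal h

theorem ofReal_coe_le_one (z : Typ) : ENNReal.ofReal (z : ℝ) ≤ 1 :=
  ENNReal.ofReal_le_one.2 z.2.2

theorem margCDF_eq {P : Measure (Typ × Typ)} {μ : Measure Typ} (hP : P.fst = μ) (z : Typ) :
    margCDF P z = μ.real (Iic z) := by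
  rw [← hP, Measure.real, Measure.fst_apply measurableSet_Iic]
  rfl

theorem measure_Iic_monotone (μ : Measure Typ) : Monotone fun z : Typ => μ (Iic z) :=
  fun _ _ h => measure_mono (Iic_subset_Iic.2 h)

theorem lowerMoment_le_measure (μ : Measure Typ) (θ : Typ) : lowerMoment μ θ ≤ μ (Iic θ) := by
  calc lowerMoment μ θ ≤ ∫⁻ _ in Iic θ, 1 ∂μ := lintegral_mono fun z => ofReal_coe_le_one z
    _ = μ (Iic θ) := by simp

theorem lowerMoment_ne_top (μ : Measure Typ) [IsProbabilityMeasure μ] (θ : Typ) : lowerMoment μ θ ≠ ∞ :=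
  ((lowerMoment_le_measure μ θ).trans_lt (measure_lt_top μ _)).ne

/-- Integration by parts through Fubini on the triangle `y ≤ z ≤ θ`: the integral of the
distribution function is that of `θ - y`. -/
theorem lintegral_measure_Iic_add_lowerMoment (μ : Measure Typ) [IsProbabilityMeasure μ] (θ : Typ) :
    (∫⁻ z in Iic θ, μ (Iic z)) + lowerMoment μ θ = ENNReal.ofReal θ * μ (Iic θ) := by
  have h1 : ∫⁻ z in Iic θ, μ (Iic z) = ∫⁻ y in Iic θ, ENNReal.ofReal (θ - y : ℝ) ∂μ := by
    have hs : MeasurableSet {x : Typ × Typ | x.2 ≤ x.1 ∧ x.1 ≤ θ} :=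
      (measurableSet_le measurable_snd measurable_fst).inter
        (measurable_fst measurableSet_Iic)
    calc ∫⁻ z in Iic θ, μ (Iic z)
        = ∫⁻ z, μ (Prod.mk z ⁻¹' {x : Typ × Typ | x.2 ≤ x.1 ∧ x.1 ≤ θ}) := by
          rw [← lintegral_indicator measurableSet_Iic]
          refine lintegral_congr fun z => ?_
          by_cases hz : z ≤ θ
          · rw [indicator_of_mem (by exact hz)]
            congr 1
            ext y
            simp [hz]
          · rw [indicator_of_notMem (by exact hz)]
            simp [hz]
      _ = ∫⁻ y, volume ((fun z => (z, y)) ⁻¹' {x : Typ × Typ | x.2 ≤ x.1 ∧ x.1 ≤ θ}) ∂μ := by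
          rw [← Measure.prod_apply hs, Measure.prod_apply_symm hs]
      _ = ∫⁻ y in Iic θ, ENNReal.ofReal (θ - y : ℝ) ∂μ := by
          rw [← lintegral_indicator measurableSet_Iic]
          refine lintegral_congr fun y => ?_
          have : (fun z => (z, y)) ⁻¹' {x : Typ × Typ | x.2 ≤ x.1 ∧ x.1 ≤ θ} = Icc y θ := by
            ext z; simp
          rw [this, unitInterval.volume_Icc]
          by_cases hy : y ≤ θ
          · rw [indicator_of_mem (by exact hy)]
          · rw [indicator_of_notMem (by exact hy), ENNReal.ofReal_eq_zero, sub_nonpos]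
            exact (not_le.1 hy).le
  rw [h1, lowerMoment, ← lintegral_add_right _ measurable_ofReal_coe]
  calc ∫⁻ y in Iic θ, (ENNReal.ofReal (θ - y : ℝ) + ENNReal.ofReal y) ∂μ
      = ∫⁻ y in Iic θ, ENNReal.ofReal θ ∂μ := by
        refine setLIntegral_congr_fun measurableSet_Iic fun y hy => ?_
        have hy' : (y : ℝ) ≤ θ := hy
        change ENNReal.ofReal (θ - y : ℝ) + ENNReal.ofReal y = ENNReal.ofReal θ
        rw [← ENNReal.ofReal_add (sub_nonneg.2 hy') y.2.1, sub_add_cancel]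
    _ = _ := setLIntegral_const _ _

theorem ofReal_mul_sub_integral_eq_lowerMoment (μ : Measure Typ) [IsProbabilityMeasure μ] (θ : Typ) :
    (θ : ℝ) * μ.real (Iic θ) - ∫ z in Iic θ, μ.real (Iic z) = (lowerMoment μ θ).toReal := by
  have h := lintegral_measure_Iic_add_lowerMoment μ θ
  have hm : Measurable fun z : Typ => μ (Iic z) := (measure_Iic_monotone μ).measurable
  have hint : ∫ z in Iic θ, μ.real (Iic z) = (∫⁻ z in Iic θ, μ (Iic z)).toReal :=
    integral_toReal hm.aemeasurable (ae_of_all _ fun z => measure_lt_top μ _)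
  have hfin : ∫⁻ z in Iic θ, μ (Iic z) ≠ ∞ := by
    intro htop
    rw [htop, top_add] at h
    exact ENNReal.mul_ne_top ENNReal.ofReal_ne_top (measure_ne_top μ _) h.symm
  have h' := congrArg ENNReal.toReal h
  rw [ENNReal.toReal_add hfin (lowerMoment_ne_top μ θ), ENNReal.toReal_mul,
    ENNReal.toReal_ofReal θ.2.1] at h'
  rw [hint, Measure.real]
  linarith

theorem bidA_eq (μ : Measure Typ) [IsProbabilityMeasure μ] {P : Measure (Typ × Typ)} (hP : P.fst = μ) (θ : Typ) :
    bidA P θ = lowerMoment μ θ := by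
  simp_rw [bidA, margCDF_eq hP]
  rw [ofReal_mul_sub_integral_eq_lowerMoment, ENNReal.ofReal_toReal (lowerMoment_ne_top μ θ)]

theorem measure_Iic_pos (μ : Measure Typ) [μ.IsOpenPosMeasure] {θ : Typ} (h : θ ≠ 0) : 0 < μ (Iic θ) := by
  have h0 : 0 < θ := unitInterval.pos_iff_ne_zero.2 h
  exact ((isOpen_Iio (a := θ)).measure_pos μ ⟨0, h0⟩).trans_le (measure_mono Iio_subset_Iic_self)

theorem measure_Ioi_pos (μ : Measure Typ) [μ.IsOpenPosMeasure] {θ : Typ} (h : θ ≠ 1) : 0 < μ (Ioi θ) :=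
  (isOpen_Ioi (a := θ)).measure_pos μ ⟨1, unitInterval.lt_one_iff_ne_one.2 h⟩

theorem measure_Iic_zero (μ : Measure Typ) [NullSingletonClass μ] : μ (Iic (0 : Typ)) = 0 := by
  have : Iic (0 : Typ) = {0} := by
    ext z; simp
  rw [this, measure_singleton]

/-- The first-price bid is the mean type below `θ`. -/
def meanBelow (μ : Measure Typ) (θ : Typ) : ℝ≥0∞ := lowerMoment μ θ / μ (Iic θ)

theorem bidI_eq (μ : Measure Typ) [IsProbabilityMeasure μ] [μ.IsOpenPosMeasure]
    [NullSingletonClass μ] {P : Measure (Typ × Typ)} (hP : P.fst = μ) (θ : Typ) :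
    bidI P θ = meanBelow μ θ := by
  rw [meanBelow]
  rcases eq_or_ne θ 0 with rfl | h0
  -- At the lowest type the distribution function vanishes, and the division conventions make both
  -- bids zero.
  · have : lowerMoment μ 0 = 0 :=
      le_antisymm ((lowerMoment_le_measure μ 0).trans (measure_Iic_zero μ).le) zero_le
    simp [bidI, this, margCDF_eq hP, Measure.real, measure_Iic_zero]
  · have hpos := measure_Iic_pos μ h0
    have hpos' : 0 < μ.real (Iic θ) := ENNReal.toReal_pos hpos.ne' (measure_ne_top μ _)
    simp_rw [bidI, margCDF_eq hP]
    rw [integral_div]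
    have : (θ : ℝ) - (∫ z in Iic θ, μ.real (Iic z)) / μ.real (Iic θ)
        = (lowerMoment μ θ).toReal / μ.real (Iic θ) := by
      rw [← ofReal_mul_sub_integral_eq_lowerMoment]
      field_simp
    rw [this, ENNReal.ofReal_div_of_pos hpos', ENNReal.ofReal_toReal (lowerMoment_ne_top μ θ),
      Measure.real, ENNReal.ofReal_toReal (measure_ne_top μ _)]

theorem meanBelow_mul (μ : Measure Typ) [IsProbabilityMeasure μ] (θ : Typ) :
    meanBelow μ θ * μ (Iic θ) = lowerMoment μ θ := by
  rcases eq_or_ne (μ (Iic θ)) 0 with h | h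
  · have := lowerMoment_le_measure μ θ
    rw [h] at this
    rw [h, mul_zero, nonpos_iff_eq_zero.1 this]
  · exact ENNReal.div_mul_cancel h (measure_ne_top μ _)

/-- Chebyshev on `Iic θ'`, with the indicator of `Iic θ` as the antitone function and the type as
the monotone one. Cleared of denominators, it says that `meanBelow` increases. -/
theorem measure_mul_lowerMoment_le (μ : Measure Typ) {θ θ' : Typ} (h : θ ≤ θ') :
    μ (Iic θ') * lowerMoment μ θ ≤ μ (Iic θ) * lowerMoment μ θ' := by
  have hanti : Antitone ((Iic θ).indicator fun _ : Typ => (1 : ℝ≥0∞)) := by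
    intro x y hxy
    by_cases hy : y ≤ θ
    · rw [indicator_of_mem (by exact hy), indicator_of_mem (by exact hxy.trans hy)]
    · rw [indicator_of_notMem (by exact hy)]
      exact zero_le
  have key := measure_univ_mul_lintegral_mul_le (μ.restrict (Iic θ'))
    (measurable_const.indicator measurableSet_Iic) measurable_ofReal_coe hanti monotone_ofReal_coe
  have hsub : Iic θ ∩ Iic θ' = Iic θ := inter_eq_left.2 (Iic_subset_Iic.2 h)
  have e1 : ∫⁻ x in Iic θ', (Iic θ).indicator (fun _ => (1 : ℝ≥0∞)) x * ENNReal.ofReal x ∂μ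
      = lowerMoment μ θ := by
    have : (fun x : Typ => (Iic θ).indicator (fun _ => (1 : ℝ≥0∞)) x * ENNReal.ofReal x)
        = (Iic θ).indicator fun x => ENNReal.ofReal x := by
      ext x
      by_cases hx : x ∈ Iic θ <;> simp only [indicator_of_mem, indicator_of_notMem, hx,
        not_false_eq_true, one_mul, zero_mul]
    rw [this, lintegral_indicator measurableSet_Iic, Measure.restrict_restrict measurableSet_Iic,
      hsub, lowerMoment]
  have e2 : ∫⁻ x in Iic θ', (Iic θ).indicator (fun _ => (1 : ℝ≥0∞)) x ∂μ = μ (Iic θ) := by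
    rw [lintegral_indicator measurableSet_Iic, Measure.restrict_restrict measurableSet_Iic, hsub,
      setLIntegral_const, one_mul]
  rwa [e1, e2, Measure.restrict_apply_univ] at key

theorem meanBelow_monotone (μ : Measure Typ) [IsProbabilityMeasure μ] :
    Monotone (meanBelow μ) := by
  intro θ θ' h
  rcases eq_or_ne (μ (Iic θ)) 0 with h0 | h0
  · have := lowerMoment_le_measure μ θ
    rw [h0] at this
    rw [meanBelow, nonpos_iff_eq_zero.1 this, ENNReal.zero_div]
    exact zero_le
  · have h0' : μ (Iic θ') ≠ 0 :=
      ((pos_iff_ne_zero.2 h0).trans_le (measure_mono (Iic_subset_Iic.2 h))).ne'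
    rw [meanBelow, meanBelow, ENNReal.le_div_iff_mul_le (Or.inl h0') (Or.inl (measure_ne_top μ _)),
      mul_comm, ← mul_div_assoc]
    exact ENNReal.div_le_of_le_mul
      ((measure_mul_lowerMoment_le μ h).trans_eq (mul_comm _ _))

theorem setLIntegral_Iic_add_Ioc (μ : Measure Typ) (g : Typ → ℝ≥0∞) {x y : Typ} (h : x ≤ y) :
    ∫⁻ z in Iic y, g z ∂μ = ∫⁻ z in Iic x, g z ∂μ + ∫⁻ z in Ioc x y, g z ∂μ := by
  rw [← Iic_union_Ioc_eq_Iic h, lintegral_union measurableSet_Ioc]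
  exact disjoint_left.2 fun z hz hz' => not_lt.2 hz hz'.1

theorem lowerMoment_strictMono (μ : Measure Typ) [IsProbabilityMeasure μ] [μ.IsOpenPosMeasure] :
    StrictMono (lowerMoment μ) := by
  intro θ θ' h
  rw [lowerMoment, lowerMoment, setLIntegral_Iic_add_Ioc μ _ h.le]
  refine ENNReal.lt_add_right (lowerMoment_ne_top μ θ) ?_
  refine ne_of_gt ?_
  rw [setLIntegral_pos_iff measurable_ofReal_coe]
  refine ((isOpen_Ioo (a := θ) (b := θ')).measure_pos μ (nonempty_Ioo.2 h)).trans_le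
    (measure_mono fun z hz => ⟨?_, hz.1, hz.2.le⟩)
  rw [Function.mem_support]
  exact (ENNReal.ofReal_pos.2 (lt_of_le_of_lt θ.2.1 hz.1)).ne'

/-- The war-of-attrition bid, as an integral against the distribution of types. -/
def attritionBid (μ : Measure Typ) (θ : Typ) : ℝ≥0∞ :=
  ∫⁻ z in Iic θ, ENNReal.ofReal z / μ (Ioi z) ∂μ

theorem attritionBid_monotone (μ : Measure Typ) : Monotone (attritionBid μ) :=
  fun _ _ h => lintegral_mono_set (Iic_subset_Iic.2 h)

theorem measurable_measure_Ioi (μ : Measure Typ) : Measurable fun z : Typ => μ (Ioi z) :=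
  Antitone.measurable fun _ _ h => measure_mono (Ioi_subset_Ioi h)

theorem one_sub_measureReal_Iic (μ : Measure Typ) [IsProbabilityMeasure μ] (z : Typ) :
    1 - μ.real (Iic z) = μ.real (Ioi z) := by
  rw [← compl_Iic, probReal_compl_eq_one_sub measurableSet_Iic]

theorem bidW_eq (μ : Measure Typ) [IsProbabilityMeasure μ] [μ.IsOpenPosMeasure]
    {P : Measure (Typ × Typ)} (hP : P.fst = μ) {f : Typ → ℝ}
    (hf : IsMargDensity P f) (θ : Typ) : bidW P f θ = attritionBid μ θ := by
  have hμ := hf.fst_eq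
  rw [hP] at hμ
  -- At `z = 1` the denominator is zero: real division returns `0`, extended division returns `∞`.
  -- The point is null.
  have hae : ∀ᵐ z : Typ ∂volume.restrict (Iic θ), z ≠ 1 :=
    ae_restrict_of_ae (compl_mem_ae_iff.2 (measure_singleton (1 : Typ)))
  have hfm : Measurable fun z => ENNReal.ofReal (f z) := ENNReal.measurable_ofReal.comp hf.measurable
  have hgm : Measurable fun z : Typ => ENNReal.ofReal z / μ (Ioi z) :=
    measurable_ofReal_coe.div (measurable_measure_Ioi μ)
  have h1 : attritionBid μ θ = ∫⁻ z in Iic θ, ENNReal.ofReal (f z) *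
      (ENNReal.ofReal z / μ (Ioi z)) := by
    refine (congrArg (fun m => ∫⁻ z in Iic θ, ENNReal.ofReal z / μ (Ioi z) ∂m) hμ).trans ?_
    exact setLIntegral_withDensity_eq_setLIntegral_mul volume hfm hgm measurableSet_Iic
  rw [h1, bidW]
  refine lintegral_congr_ae ?_
  filter_upwards [hae] with z hz
  have hpos : 0 < μ.real (Ioi z) :=
    ENNReal.toReal_pos (measure_Ioi_pos μ hz).ne' (measure_ne_top μ _)
  rw [margCDF_eq hP, one_sub_measureReal_Iic, ENNReal.ofReal_div_of_pos hpos,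
    ENNReal.ofReal_mul z.2.1, Measure.real, ENNReal.ofReal_toReal (measure_ne_top μ _),
    mul_comm, mul_div_assoc]

/-! ### Interim comparison of payments against a decreasing density -/

/-- Ties have probability zero, so the tie-breaking payment `b` disappears. -/
theorem lintegral_mul_winner (μ : Measure Typ) [NullSingletonClass μ] (q a b : Typ → ℝ≥0∞)
    (θ : Typ) :
    ∫⁻ θ', q θ' * (if θ' < θ then a θ' else if θ = θ' then b θ' else 0) ∂μ
      = ∫⁻ θ' in Iic θ, q θ' * a θ' ∂μ := by
  rw [← lintegral_indicator measurableSet_Iic]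
  refine lintegral_congr_ae ?_
  have hae : ∀ᵐ z : Typ ∂μ, z ≠ θ := compl_mem_ae_iff.2 (measure_singleton θ)
  filter_upwards [hae] with z hz
  rcases lt_or_gt_of_ne hz with h | h
  · rw [indicator_of_mem (by exact h.le), if_pos h]
  · rw [indicator_of_notMem (by exact not_le.2 h), if_neg (not_lt.2 h.le), if_neg h.ne, mul_zero]

/-- The value `q θ` separates the values of `q` on the two sides of `θ`, so the average below `θ` is
at least the overall average. -/
theorem measure_Iic_mul_lintegral_le (μ : Measure Typ) [IsProbabilityMeasure μ]
    {q : Typ → ℝ≥0∞} (hq : Antitone q) (θ : Typ) :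
    μ (Iic θ) * ∫⁻ x, q x ∂μ ≤ ∫⁻ x in Iic θ, q x ∂μ := by
  have h1 : ∫⁻ x in Ioi θ, q x ∂μ ≤ q θ * μ (Ioi θ) := by
    rw [← setLIntegral_const]
    exact setLIntegral_mono' measurableSet_Ioi fun x hx => hq (le_of_lt hx)
  have h2 : q θ * μ (Iic θ) ≤ ∫⁻ x in Iic θ, q x ∂μ := by
    rw [← setLIntegral_const]
    exact setLIntegral_mono' measurableSet_Iic fun x hx => hq hx
  have hsum : μ (Iic θ) + μ (Ioi θ) = 1 := by
    rw [← compl_Iic, measure_add_measure_compl measurableSet_Iic, measure_univ]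
  calc μ (Iic θ) * ∫⁻ x, q x ∂μ
      = μ (Iic θ) * ∫⁻ x in Iic θ, q x ∂μ + μ (Iic θ) * ∫⁻ x in Ioi θ, q x ∂μ := by
        rw [← mul_add, ← compl_Iic, lintegral_add_compl _ measurableSet_Iic]
    _ ≤ μ (Iic θ) * ∫⁻ x in Iic θ, q x ∂μ + μ (Ioi θ) * ∫⁻ x in Iic θ, q x ∂μ := by
        refine add_le_add le_rfl ?_
        calc μ (Iic θ) * ∫⁻ x in Ioi θ, q x ∂μ ≤ μ (Iic θ) * (q θ * μ (Ioi θ)) := by gcongr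
          _ = μ (Ioi θ) * (q θ * μ (Iic θ)) := by ring
          _ ≤ _ := by gcongr
    _ = _ := by rw [← add_mul, hsum, one_mul]

/-- First price against second price: Chebyshev on `Iic θ`, where the type has mean `meanBelow μ θ`.
-/
theorem setLIntegral_mul_type_le (μ : Measure Typ) [IsProbabilityMeasure μ]
    {q : Typ → ℝ≥0∞} (hqm : Measurable q) (hq : Antitone q) (θ : Typ) :
    ∫⁻ x in Iic θ, q x * ENNReal.ofReal x ∂μ ≤ ∫⁻ x in Iic θ, q x * meanBelow μ θ ∂μ := by
  rcases eq_or_ne (μ (Iic θ)) 0 with h0 | h0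
  · rw [Measure.restrict_eq_zero.2 h0]; simp
  have key := measure_univ_mul_lintegral_mul_le (μ.restrict (Iic θ)) hqm measurable_ofReal_coe hq
    monotone_ofReal_coe
  rw [Measure.restrict_apply_univ] at key
  rw [lintegral_mul_const _ hqm]
  rw [← ENNReal.mul_le_mul_iff_right h0 (measure_ne_top μ _)]
  refine key.trans_eq ?_
  change _ * lowerMoment μ θ = _
  rw [← meanBelow_mul]
  ring

/-- First price against all-pay: the all-pay bid is the first-price bid times the reference
probability of winning, which an antitone density can only raise in relative terms. -/
theorem lintegral_mul_lowerMoment_le (μ : Measure Typ) [IsProbabilityMeasure μ]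
    {q : Typ → ℝ≥0∞} (hqm : Measurable q) (hq : Antitone q) (θ : Typ) :
    ∫⁻ x, q x * lowerMoment μ θ ∂μ ≤ ∫⁻ x in Iic θ, q x * meanBelow μ θ ∂μ := by
  rw [lintegral_mul_const _ hqm, lintegral_mul_const _ hqm, ← meanBelow_mul]
  calc (∫⁻ x, q x ∂μ) * (meanBelow μ θ * μ (Iic θ))
      = meanBelow μ θ * (μ (Iic θ) * ∫⁻ x, q x ∂μ) := by ring
    _ ≤ meanBelow μ θ * ∫⁻ x in Iic θ, q x ∂μ := by
        gcongr; exact measure_Iic_mul_lintegral_le μ hq θ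
    _ = _ := mul_comm _ _

/-- Interim revenue equivalence with the all-pay auction: after Fubini, the denominator `μ (Ioi z)`
cancels against the probability that the competitor's type is at least `z`. -/
theorem lintegral_attritionBid_min (μ : Measure Typ) [IsProbabilityMeasure μ]
    [μ.IsOpenPosMeasure] [NullSingletonClass μ] (θ : Typ) :
    ∫⁻ θ', attritionBid μ (min θ θ') ∂μ = lowerMoment μ θ := by
  set g : Typ → ℝ≥0∞ := fun z => ENNReal.ofReal z / μ (Ioi z) with hg
  have hgm : Measurable g := measurable_ofReal_coe.div (measurable_measure_Ioi μ)
  have hs : MeasurableSet {p : Typ × Typ | p.2 ≤ p.1} :=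
    measurableSet_le (α := Typ) measurable_snd measurable_fst
  calc ∫⁻ θ', attritionBid μ (min θ θ') ∂μ
      = ∫⁻ θ', ∫⁻ z in Iic θ, {p : Typ × Typ | p.2 ≤ p.1}.indicator (fun p => g p.2) (θ', z)
          ∂μ ∂μ := by
        refine lintegral_congr fun θ' => ?_
        have : (fun z => {p : Typ × Typ | p.2 ≤ p.1}.indicator (fun p => g p.2) (θ', z))
            = (Iic θ').indicator g := by
          ext z
          by_cases hz : z ≤ θ'
          · rw [indicator_of_mem (by exact hz), indicator_of_mem (by exact hz)]
          · rw [indicator_of_notMem (by exact hz), indicator_of_notMem (by exact hz)]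
        rw [this, lintegral_indicator measurableSet_Iic, Measure.restrict_restrict measurableSet_Iic,
          Iic_inter_Iic, inf_comm]
        rfl
    _ = ∫⁻ z in Iic θ, ∫⁻ θ', {p : Typ × Typ | p.2 ≤ p.1}.indicator (fun p => g p.2) (θ', z)
          ∂μ ∂μ :=
        lintegral_lintegral_swap (((hgm.comp measurable_snd).indicator hs).aemeasurable)
    _ = lowerMoment μ θ := by
        refine lintegral_congr_ae (ae_restrict_of_ae ?_)
        have hae : ∀ᵐ z : Typ ∂μ, z ≠ 1 := compl_mem_ae_iff.2 (measure_singleton 1)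
        filter_upwards [hae] with z hz
        have : (fun θ' => {p : Typ × Typ | p.2 ≤ p.1}.indicator (fun p => g p.2) (θ', z))
            = (Ici z).indicator fun _ => g z := by
          ext θ'
          by_cases hz : z ≤ θ'
          · rw [indicator_of_mem (by exact hz), indicator_of_mem (by exact hz)]
          · rw [indicator_of_notMem (by exact hz), indicator_of_notMem (by exact hz)]
        rw [this, lintegral_indicator measurableSet_Ici, setLIntegral_const,
          ← measure_congr (Ioi_ae_eq_Ici (μ := μ))]
        exact ENNReal.div_mul_cancel (measure_Ioi_pos μ hz).ne' (measure_ne_top μ _)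

/-- All-pay against war of attrition: Chebyshev for a payment increasing in the competitor's type,
with mean the all-pay bid. -/
theorem lintegral_mul_attritionBid_le (μ : Measure Typ) [IsProbabilityMeasure μ]
    [μ.IsOpenPosMeasure] [NullSingletonClass μ] {q : Typ → ℝ≥0∞} (hqm : Measurable q)
    (hq : Antitone q) (θ : Typ) :
    ∫⁻ θ', q θ' * attritionBid μ (min θ θ') ∂μ ≤ ∫⁻ θ', q θ' * lowerMoment μ θ ∂μ := by
  have hmono : Monotone fun θ' => attritionBid μ (min θ θ') :=
    fun _ _ h => attritionBid_monotone μ (min_le_min le_rfl h)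
  have key := measure_univ_mul_lintegral_mul_le μ hqm hmono.measurable hq hmono
  rwa [measure_univ, one_mul, lintegral_attritionBid_min, ← lintegral_mul_const _ hqm] at key

/-! ### From interim payments to revenue -/

/-- The revenue from a profile at which each bidder's payment is given by `T`. -/
def revenue (T : Typ → Typ → ℝ≥0∞) (x : Typ × Typ) : ℝ≥0∞ := T x.1 x.2 + T x.2 x.1

theorem lintegral_mul_revenue (μ : Measure Typ) [IsProbabilityMeasure μ]
    {T : Typ → Typ → ℝ≥0∞} (hT : Measurable (Function.uncurry T)) {q : Typ × Typ → ℝ≥0∞}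
    (hq : Measurable q) :
    ∫⁻ x, q x * revenue T x ∂(μ.prod μ)
      = ∫⁻ θ, ∫⁻ θ', q (θ, θ') * T θ θ' ∂μ ∂μ + ∫⁻ θ, ∫⁻ θ', q (θ', θ) * T θ θ' ∂μ ∂μ := by
  have hT1 : Measurable fun x : Typ × Typ => q x * T x.1 x.2 := hq.mul hT
  have hT2 : Measurable fun x : Typ × Typ => q x * T x.2 x.1 := hq.mul (hT.comp measurable_swap)
  simp_rw [revenue, mul_add]
  -- The second summand is integrated in the opposite order, so that the outer variable is each
  -- bidder's own type.
  rw [lintegral_add_left hT1, lintegral_prod _ hT1.aemeasurable, lintegral_prod_symm' _ hT2]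

theorem lintegral_mul_revenue_le (μ : Measure Typ) [IsProbabilityMeasure μ]
    {T T' : Typ → Typ → ℝ≥0∞} (hT : Measurable (Function.uncurry T))
    (hT' : Measurable (Function.uncurry T'))
    (h : ∀ q : Typ → ℝ≥0∞, Measurable q → Antitone q → ∀ θ,
      ∫⁻ θ', q θ' * T θ θ' ∂μ ≤ ∫⁻ θ', q θ' * T' θ θ' ∂μ)
    {q : Typ × Typ → ℝ≥0∞} (hqm : Measurable q) (hq : Antitone q) :
    ∫⁻ x, q x * revenue T x ∂(μ.prod μ) ≤ ∫⁻ x, q x * revenue T' x ∂(μ.prod μ) := by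
  rw [lintegral_mul_revenue μ hT hqm, lintegral_mul_revenue μ hT' hqm]
  refine add_le_add (lintegral_mono fun θ => ?_) (lintegral_mono fun θ => ?_)
  · exact h _ (hqm.comp measurable_prodMk_left) (fun a b hab => hq ⟨le_rfl, hab⟩) θ
  · exact h _ (hqm.comp measurable_prodMk_right) (fun a b hab => hq ⟨hab, le_rfl⟩) θ

/-! ### The second-price auction and the war of attrition -/

/-- The weight of the lowest type `θ` under the density `q`. -/
def lowWeight (μ : Measure Typ) (q : Typ × Typ → ℝ≥0∞) (θ : Typ) : ℝ≥0∞ :=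
  ∫⁻ θ' in Ioi θ, q (θ, θ') ∂μ + ∫⁻ θ' in Ioi θ, q (θ', θ) ∂μ

theorem measurable_setLIntegral_Ioi (μ : Measure Typ) [IsProbabilityMeasure μ]
    {q : Typ × Typ → ℝ≥0∞} (hq : Measurable q) :
    Measurable fun θ => ∫⁻ θ' in Ioi θ, q (θ, θ') ∂μ := by
  have hlt : MeasurableSet {x : Typ × Typ | x.1 < x.2} :=
    measurableSet_lt (α := Typ) measurable_fst measurable_snd
  have h := (hq.indicator hlt).lintegral_prod_right' (ν := μ)
  convert h using 2 with θ
  rw [← lintegral_indicator measurableSet_Ioi]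
  refine lintegral_congr fun θ' => ?_
  by_cases hθ : θ < θ'
  · rw [indicator_of_mem (by exact hθ), indicator_of_mem (by exact hθ)]
  · rw [indicator_of_notMem (by exact hθ), indicator_of_notMem (by exact hθ)]

theorem measure_prod_diagonal (μ : Measure Typ) [IsProbabilityMeasure μ] [NullSingletonClass μ] :
    (μ.prod μ) {x | x.1 = x.2} = 0 := by
  have hs : MeasurableSet {x : Typ × Typ | x.1 = x.2} :=
    measurableSet_eq_fun measurable_fst measurable_snd
  rw [Measure.measure_prod_null hs]
  refine ae_of_all _ fun x => ?_
  have : Prod.mk x ⁻¹' {x : Typ × Typ | x.1 = x.2} = {x} := by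
    ext y; exact eq_comm
  change μ (Prod.mk x ⁻¹' {x : Typ × Typ | x.1 = x.2}) = 0
  rw [this, measure_singleton]

theorem lintegral_mul_min (μ : Measure Typ) [IsProbabilityMeasure μ] [NullSingletonClass μ]
    {h : Typ → ℝ≥0∞} (hh : Measurable h) {q : Typ × Typ → ℝ≥0∞} (hq : Measurable q) :
    ∫⁻ x, q x * h (min x.1 x.2) ∂(μ.prod μ) = ∫⁻ θ, lowWeight μ q θ * h θ ∂μ := by
  -- Off the null diagonal, `h` of the minimum is the revenue when only the bidder with the lower
  -- type pays.
  set T : Typ → Typ → ℝ≥0∞ := fun θ θ' => if θ < θ' then h θ else 0 with hT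
  have hlt : MeasurableSet {x : Typ × Typ | x.1 < x.2} :=
    measurableSet_lt (α := Typ) measurable_fst measurable_snd
  have hTm : Measurable (Function.uncurry T) :=
    Measurable.ite hlt (hh.comp measurable_fst) measurable_const
  have h1 : ∫⁻ x, q x * h (min x.1 x.2) ∂(μ.prod μ) = ∫⁻ x, q x * revenue T x ∂(μ.prod μ) := by
    refine lintegral_congr_ae ?_
    have hae : ∀ᵐ x ∂(μ.prod μ), ¬ x.1 = x.2 := compl_mem_ae_iff.2 (measure_prod_diagonal μ)
    filter_upwards [hae] with x hx
    rcases lt_or_gt_of_ne hx with hlt | hlt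
    · simp only [revenue, hT]
      rw [if_pos hlt, if_neg hlt.not_gt, add_zero, min_eq_left hlt.le]
    · simp only [revenue, hT]
      rw [if_pos hlt, if_neg hlt.not_gt, zero_add, min_eq_right hlt.le]
  have h2 : ∀ (p : Typ → ℝ≥0∞) (θ : Typ), Measurable p →
      ∫⁻ θ', p θ' * T θ θ' ∂μ = (∫⁻ θ' in Ioi θ, p θ' ∂μ) * h θ := by
    intro p θ hp
    rw [← lintegral_mul_const _ hp, ← lintegral_indicator measurableSet_Ioi]
    refine lintegral_congr fun θ' => ?_
    by_cases hθ : θ < θ'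
    · simp only [hT]
      rw [indicator_of_mem (by exact hθ), if_pos hθ]
    · simp only [hT]
      rw [indicator_of_notMem (by exact hθ), if_neg hθ, mul_zero]
  rw [h1, lintegral_mul_revenue μ hTm hq]
  simp_rw [fun θ => h2 (fun θ' => q (θ, θ')) θ (hq.comp measurable_prodMk_left),
    fun θ => h2 (fun θ' => q (θ', θ)) θ (hq.comp measurable_prodMk_right)]
  rw [← lintegral_add_left]
  · simp_rw [lowWeight, add_mul]
  · exact (measurable_setLIntegral_Ioi μ hq).mul hh

theorem measurable_lowWeight (μ : Measure Typ) [IsProbabilityMeasure μ]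
    {q : Typ × Typ → ℝ≥0∞} (hq : Measurable q) : Measurable (lowWeight μ q) :=
  (measurable_setLIntegral_Ioi μ hq).add (measurable_setLIntegral_Ioi μ (hq.comp measurable_swap))

/-- Chebyshev on `Ioi θ` against the indicator of `Ioi θ'`: tail averages of an antitone function
decrease. -/
theorem setLIntegral_Ioi_mul_le (μ : Measure Typ) {q : Typ → ℝ≥0∞} (hqm : Measurable q)
    (hq : Antitone q) {θ θ' : Typ} (h : θ ≤ θ') :
    μ (Ioi θ) * ∫⁻ x in Ioi θ', q x ∂μ ≤ μ (Ioi θ') * ∫⁻ x in Ioi θ, q x ∂μ := by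
  have hmono : Monotone ((Ioi θ').indicator fun _ : Typ => (1 : ℝ≥0∞)) := by
    intro x y hxy
    by_cases hx : θ' < x
    · rw [indicator_of_mem (by exact hx), indicator_of_mem (by exact lt_of_lt_of_le hx hxy)]
    · rw [indicator_of_notMem (by exact hx)]
      exact zero_le
  have key := measure_univ_mul_lintegral_mul_le (μ.restrict (Ioi θ)) hqm
    (measurable_const.indicator measurableSet_Ioi) hq hmono
  have hsub : Ioi θ' ∩ Ioi θ = Ioi θ' := inter_eq_left.2 (Ioi_subset_Ioi h)
  have e1 : ∫⁻ x in Ioi θ, q x * (Ioi θ').indicator (fun _ => (1 : ℝ≥0∞)) x ∂μ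
      = ∫⁻ x in Ioi θ', q x ∂μ := by
    have : (fun x : Typ => q x * (Ioi θ').indicator (fun _ => (1 : ℝ≥0∞)) x)
        = (Ioi θ').indicator q := by
      ext x
      by_cases hx : x ∈ Ioi θ' <;> simp only [indicator_of_mem, indicator_of_notMem, hx,
        not_false_eq_true, mul_one, mul_zero]
    rw [this, lintegral_indicator measurableSet_Ioi, Measure.restrict_restrict measurableSet_Ioi,
      hsub]
  have e2 : ∫⁻ x in Ioi θ, (Ioi θ').indicator (fun _ => (1 : ℝ≥0∞)) x ∂μ = μ (Ioi θ') := by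
    rw [lintegral_indicator measurableSet_Ioi, Measure.restrict_restrict measurableSet_Ioi, hsub,
      setLIntegral_const, one_mul]
  rw [e1, e2, Measure.restrict_apply_univ] at key
  exact key.trans_eq (mul_comm _ _)

/-- The ratio of `lowWeight` to `μ (Ioi θ)` is decreasing for two reasons: `q` falls in the lower
type, and its average over the higher type falls as the tail shrinks. -/
theorem lowWeight_mul_le (μ : Measure Typ) {q : Typ × Typ → ℝ≥0∞} (hqm : Measurable q)
    (hq : Antitone q) {θ θ' : Typ} (h : θ ≤ θ') :
    μ (Ioi θ) * lowWeight μ q θ' ≤ μ (Ioi θ') * lowWeight μ q θ := by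
  rw [lowWeight, lowWeight, mul_add, mul_add]
  refine add_le_add ?_ ?_
  · calc μ (Ioi θ) * ∫⁻ x in Ioi θ', q (θ', x) ∂μ ≤ μ (Ioi θ) * ∫⁻ x in Ioi θ', q (θ, x) ∂μ := by
          gcongr with x
          exact hq ⟨h, le_rfl⟩
      _ ≤ _ := setLIntegral_Ioi_mul_le μ (hqm.comp measurable_prodMk_left)
          (fun a b hab => hq ⟨le_rfl, hab⟩) h
  · calc μ (Ioi θ) * ∫⁻ x in Ioi θ', q (x, θ') ∂μ ≤ μ (Ioi θ) * ∫⁻ x in Ioi θ', q (x, θ) ∂μ := by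
          gcongr with x
          exact hq ⟨le_rfl, h⟩
      _ ≤ _ := setLIntegral_Ioi_mul_le μ (hqm.comp measurable_prodMk_right)
          (fun a b hab => hq ⟨hab, le_rfl⟩) h

/-- A decreasing weight shifts integrals towards the function that dominates first. -/
theorem lintegral_mul_le_of_crossing (μ : Measure Typ) [IsProbabilityMeasure μ]
    [μ.IsOpenPosMeasure] [NullSingletonClass μ] {h k u : Typ → ℝ≥0∞} (hh : Measurable h)
    (hk : Measurable k) (hu : Measurable u) {B : ℝ≥0∞} (hB : B ≠ ∞)
    (huB : ∀ θ, u θ ≤ B * μ (Ioi θ))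
    (hanti : ∀ θ θ', θ ≤ θ' → μ (Ioi θ) * u θ' ≤ μ (Ioi θ') * u θ)
    (hcross : ∀ x y, x < y → y < 1 → k x < h x → k y ≤ h y)
    (hkfin : ∫⁻ θ, μ (Ioi θ) * k θ ∂μ ≠ ∞)
    (hle : ∫⁻ θ, μ (Ioi θ) * h θ ∂μ ≤ ∫⁻ θ, μ (Ioi θ) * k θ ∂μ) :
    ∫⁻ θ, u θ * h θ ∂μ ≤ ∫⁻ θ, u θ * k θ ∂μ := by
  set w : Typ → ℝ≥0∞ := fun θ => u θ / μ (Ioi θ) with hw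
  have hr : ∀ θ : Typ, θ ≠ 1 → μ (Ioi θ) ≠ 0 := fun θ hθ => (measure_Ioi_pos μ hθ).ne'
  have hrt : ∀ θ : Typ, μ (Ioi θ) ≠ ∞ := fun θ => measure_ne_top μ _
  have hrm := measurable_measure_Ioi μ
  have hwr : ∀ θ, θ ≠ 1 → w θ * μ (Ioi θ) = u θ := fun θ hθ =>
    ENNReal.div_mul_cancel (hr θ hθ) (hrt θ)
  have hwB : ∀ θ, w θ ≤ B := fun θ => ENNReal.div_le_of_le_mul (huB θ)
  have hwanti : ∀ x y, x ≤ y → y < 1 → w y ≤ w x := fun x y hxy hy => by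
    have hx := hr x (lt_of_le_of_lt hxy hy).ne
    rw [hw]
    change u y / μ (Ioi y) ≤ u x / μ (Ioi x)
    rw [ENNReal.le_div_iff_mul_le (Or.inl hx) (Or.inl (hrt x)), mul_comm, ← mul_div_assoc]
    exact ENNReal.div_le_of_le_mul ((hanti x y hxy).trans_eq (mul_comm _ _))
  -- This is the value of the decreasing ratio `w` at the crossing: `w ≤ c` where `h > k`, and `c ≤
  -- w` where `h < k`, since points of the first kind lie to the right of the second. Hence `(w - c)
  -- * (h - k) ≤ 0` pointwise.
  set c : ℝ≥0∞ := ⨆ y : {y : Typ // y < 1 ∧ k y < h y}, w y with hc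
  have hcfin : c ≠ ∞ :=
    (lt_of_le_of_lt (iSup_le fun _ => hwB _) (lt_top_iff_ne_top.2 hB)).ne
  have hpt : ∀ x : Typ, x < 1 → w x * h x + c * k x ≤ w x * k x + c * h x := by
    intro x hx
    rcases lt_trichotomy (k x) (h x) with hlt | heq | hgt
    · exact ennreal_mul_add_mul_le
        (le_iSup (fun y : {y : Typ // y < 1 ∧ k y < h y} => w y) ⟨x, hx, hlt⟩) hlt.le
    · rw [heq]
    · have hcw : c ≤ w x := by
        refine iSup_le fun y => ?_
        rcases lt_trichotomy x y.1 with hxy | hxy | hxy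
        · exact hwanti _ _ hxy.le y.2.1
        · exact absurd y.2.2 (hxy ▸ hgt.not_gt)
        · exact absurd (hcross _ _ hxy hx y.2.2) (not_le.2 hgt)
      calc w x * h x + c * k x = c * k x + w x * h x := add_comm _ _
        _ ≤ c * h x + w x * k x := ennreal_mul_add_mul_le hcw hgt.le
        _ = _ := add_comm _ _
  have hint : ∫⁻ θ, (u θ * h θ + c * (μ (Ioi θ) * k θ)) ∂μ
      ≤ ∫⁻ θ, (u θ * k θ + c * (μ (Ioi θ) * h θ)) ∂μ := by
    refine lintegral_mono_ae ?_
    have hae : ∀ᵐ z : Typ ∂μ, z ≠ 1 := compl_mem_ae_iff.2 (measure_singleton 1)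
    filter_upwards [hae] with x hx
    rw [← hwr x hx]
    calc w x * μ (Ioi x) * h x + c * (μ (Ioi x) * k x)
        = μ (Ioi x) * (w x * h x + c * k x) := by ring
      _ ≤ μ (Ioi x) * (w x * k x + c * h x) := by
          exact mul_le_mul_right (hpt x (unitInterval.lt_one_iff_ne_one.2 hx)) _
      _ = _ := by ring
  have hum : Measurable fun θ => u θ * h θ := hu.mul hh
  have hum' : Measurable fun θ => u θ * k θ := hu.mul hk
  have hrk : Measurable fun θ => μ (Ioi θ) * k θ := hrm.mul hk
  have hrh : Measurable fun θ => μ (Ioi θ) * h θ := hrm.mul hh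
  rw [lintegral_add_left hum, lintegral_add_left hum', lintegral_const_mul _ hrk,
    lintegral_const_mul _ hrh] at hint
  -- The common term must be finite to cancel: the bound `B` controls `c`, and `hkfin` controls the
  -- integral.
  refine (ENNReal.add_le_add_iff_right (ENNReal.mul_ne_top hcfin hkfin)).1 (hint.trans ?_)
  gcongr

theorem lintegral_mul_min_le_of_crossing (μ : Measure Typ) [IsProbabilityMeasure μ]
    [μ.IsOpenPosMeasure] [NullSingletonClass μ] {h k : Typ → ℝ≥0∞} (hh : Measurable h)
    (hk : Measurable k) (hcross : ∀ x y, x < y → y < 1 → k x < h x → k y ≤ h y)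
    (hkfin : ∫⁻ θ, μ (Ioi θ) * k θ ∂μ ≠ ∞)
    (hle : ∫⁻ θ, μ (Ioi θ) * h θ ∂μ ≤ ∫⁻ θ, μ (Ioi θ) * k θ ∂μ)
    {q : Typ × Typ → ℝ≥0∞} (hqm : Measurable q) (hq : Antitone q) :
    ∫⁻ x, q x * h (min x.1 x.2) ∂(μ.prod μ) ≤ ∫⁻ x, q x * k (min x.1 x.2) ∂(μ.prod μ) := by
  have hhmin : Measurable fun x : Typ × Typ => h (min x.1 x.2) :=
    hh.comp (measurable_fst.min measurable_snd)
  -- Truncating `q` at `n` keeps it antitone and bounds its low weight by `(n + n) * μ (Ioi θ)`;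
  -- monotone convergence removes the truncation.
  have htrunc : ∀ x, q x * h (min x.1 x.2) = ⨆ n : ℕ, min (q x) n * h (min x.1 x.2) := by
    intro x
    rw [← ENNReal.iSup_mul, ← inf_iSup_eq, ENNReal.iSup_natCast, inf_top_eq]
  have htm : ∀ n : ℕ, Measurable fun x => min (q x) (n : ℝ≥0∞) * h (min x.1 x.2) :=
    fun n => (hqm.min measurable_const).mul hhmin
  simp_rw [htrunc]
  rw [lintegral_iSup htm]
  · refine iSup_le fun n => ?_
    have hqn : Measurable fun x => min (q x) (n : ℝ≥0∞) := hqm.min measurable_const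
    have hqa : Antitone fun x => min (q x) (n : ℝ≥0∞) := fun _ _ hxy => min_le_min (hq hxy) le_rfl
    calc ∫⁻ x, min (q x) (n : ℝ≥0∞) * h (min x.1 x.2) ∂(μ.prod μ)
        ≤ ∫⁻ x, min (q x) (n : ℝ≥0∞) * k (min x.1 x.2) ∂(μ.prod μ) := by
          rw [lintegral_mul_min μ hh hqn, lintegral_mul_min μ hk hqn]
          refine lintegral_mul_le_of_crossing μ hh hk (measurable_lowWeight μ hqn)
            (B := n + n) (by simp) (fun θ => ?_)
            (fun θ θ' hθ => lowWeight_mul_le μ hqn hqa hθ) hcross hkfin hle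
          rw [lowWeight, add_mul, ← setLIntegral_const]
          exact add_le_add (lintegral_mono fun _ => min_le_right _ _)
            (lintegral_mono fun _ => min_le_right _ _)
      _ ≤ _ := by
          gcongr with x
          exact min_le_left _ _
  · intro m n hmn x
    change min (q x) (m : ℝ≥0∞) * h (min x.1 x.2) ≤ min (q x) (n : ℝ≥0∞) * h (min x.1 x.2)
    gcongr

theorem lintegral_lowerMoment (μ : Measure Typ) [IsProbabilityMeasure μ] [NullSingletonClass μ] :
    ∫⁻ θ, lowerMoment μ θ ∂μ = ∫⁻ θ, μ (Ioi θ) * ENNReal.ofReal θ ∂μ := by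
  have hs : MeasurableSet {p : Typ × Typ | p.2 ≤ p.1} :=
    measurableSet_le (α := Typ) measurable_snd measurable_fst
  calc ∫⁻ θ, lowerMoment μ θ ∂μ
      = ∫⁻ θ, ∫⁻ z, {p : Typ × Typ | p.2 ≤ p.1}.indicator (fun p => ENNReal.ofReal p.2) (θ, z)
          ∂μ ∂μ := by
        refine lintegral_congr fun θ => ?_
        rw [lowerMoment, ← lintegral_indicator measurableSet_Iic]
        rfl
    _ = ∫⁻ z, ∫⁻ θ, {p : Typ × Typ | p.2 ≤ p.1}.indicator (fun p => ENNReal.ofReal p.2) (θ, z)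
          ∂μ ∂μ :=
        lintegral_lintegral_swap
          (((measurable_ofReal_coe.comp measurable_snd).indicator hs).aemeasurable)
    _ = _ := by
        refine lintegral_congr fun z => ?_
        have : (fun θ => {p : Typ × Typ | p.2 ≤ p.1}.indicator (fun p => ENNReal.ofReal p.2) (θ, z))
            = (Ici z).indicator fun _ => ENNReal.ofReal z := rfl
        rw [this, lintegral_indicator measurableSet_Ici, setLIntegral_const,
          ← measure_congr (Ioi_ae_eq_Ici (μ := μ)), mul_comm]

/-- Revenue equivalence of the second-price auction and the war of attrition. -/
theorem lintegral_two_mul_attritionBid (μ : Measure Typ) [IsProbabilityMeasure μ]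
    [μ.IsOpenPosMeasure] [NullSingletonClass μ] :
    ∫⁻ θ, μ (Ioi θ) * (2 * attritionBid μ θ) ∂μ = ∫⁻ θ, μ (Ioi θ) * ENNReal.ofReal θ ∂μ := by
  have hWm : Measurable (attritionBid μ) := (attritionBid_monotone μ).measurable
  -- For the constant density, `lowWeight` is `2 * μ (Ioi θ)`, which accounts for the factor two.
  have h1 := lintegral_mul_min μ hWm (q := fun _ => 1) measurable_const
  have hm : Measurable fun x : Typ × Typ => 1 * attritionBid μ (min x.1 x.2) :=
    (hWm.comp (measurable_fst.min measurable_snd)).const_mul 1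
  rw [lintegral_prod _ hm.aemeasurable] at h1
  simp only [one_mul, lintegral_attritionBid_min] at h1
  rw [lintegral_lowerMoment] at h1
  rw [h1]
  refine lintegral_congr fun θ => ?_
  rw [lowWeight, setLIntegral_const, one_mul]
  ring

theorem volume_Iic_typ (θ : Typ) : volume (Iic θ) = ENNReal.ofReal θ := by
  simp

theorem volume_Ioc_typ (x y : Typ) : volume (Ioc x y) = ENNReal.ofReal (y - x) := by
  simp

/-- Single crossing: if twice the bid exceeds the type at `x`, its slope exceeds one somewhere below
`x`. The monotone integrand keeps the slope above one from there on, so twice the bid stays ahead.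
-/
theorem ofReal_le_two_mul_bidW_of_lt (P : Measure (Typ × Typ)) (f : Typ → ℝ)
    (hmono : MonotoneOn (fun θ : Typ => (θ : ℝ) * f θ / (1 - margCDF P θ)) (Iio 1))
    {x y : Typ} (hxy : x < y) (hy : y < 1) (hx : ENNReal.ofReal x < 2 * bidW P f x) :
    ENNReal.ofReal y ≤ 2 * bidW P f y := by
  set r : Typ → ℝ := fun θ => (θ : ℝ) * f θ / (1 - margCDF P θ) with hr
  obtain ⟨z, hzx, hz⟩ : ∃ z ≤ x, 1 < 2 * ENNReal.ofReal (r z) := by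
    by_contra! hcon
    refine absurd hx (not_lt.2 ?_)
    rw [bidW, ← lintegral_const_mul' _ _ (by simp)]
    calc ∫⁻ z in Iic x, 2 * ENNReal.ofReal (r z) ≤ ∫⁻ _ in Iic x, 1 :=
          setLIntegral_mono' measurableSet_Iic fun z hz => hcon z hz
      _ = _ := by rw [setLIntegral_const, one_mul, volume_Iic_typ]
  have hIoc : ENNReal.ofReal (y - x) ≤ 2 * ∫⁻ z in Ioc x y, ENNReal.ofReal (r z) := by
    rw [← lintegral_const_mul' _ _ (by simp), ← volume_Ioc_typ, ← setLIntegral_one]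
    refine setLIntegral_mono' measurableSet_Ioc fun w hw => hz.le.trans ?_
    gcongr
    exact hmono (lt_of_le_of_lt hzx (hxy.trans hy)) (lt_of_le_of_lt hw.2 hy) (hzx.trans hw.1.le)
  rw [bidW, setLIntegral_Iic_add_Ioc volume _ hxy.le, mul_add]
  calc ENNReal.ofReal y = ENNReal.ofReal x + ENNReal.ofReal (y - x) := by
        rw [← ENNReal.ofReal_add x.2.1 (sub_nonneg.2 hxy.le), add_sub_cancel]
    _ ≤ _ := add_le_add hx.le hIoc

/-! ### Rearranging priors -/

section Priors

variable {Ω : Type*} [MeasurableSpace Ω]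

theorem isRearrangement_withDensity (P : Measure Ω) [IsProbabilityMeasure P] {Q : Measure Ω}
    {q q' : Ω → ℝ≥0∞} (hq : Measurable q) (hq' : Measurable q') (hQ : Q.rnDeriv P =ᵐ[P] q)
    (hmap : P.map q' = P.map q) : IsRearrangement P (P.withDensity q') Q := by
  intro c
  have h1 : P {ω | (P.withDensity q').rnDeriv P ω ≤ c} = P (q' ⁻¹' Iic (c : ℝ≥0∞)) := by
    refine measure_congr ?_
    filter_upwards [Measure.rnDeriv_withDensity P hq'] with ω hω
    refine propext ?_
    change (P.withDensity q').rnDeriv P ω ≤ c ↔ q' ω ≤ c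
    rw [hω]
  have h2 : P {ω | Q.rnDeriv P ω ≤ c} = P (q ⁻¹' Iic (c : ℝ≥0∞)) := by
    refine measure_congr ?_
    filter_upwards [hQ] with ω hω
    refine propext ?_
    change Q.rnDeriv P ω ≤ c ↔ q ω ≤ c
    rw [hω]
  rw [h1, h2, ← Measure.map_apply hq' measurableSet_Iic, ← Measure.map_apply hq measurableSet_Iic,
    hmap]

/-- Equality of the laws of the densities preserves total mass, and one rearrangement serves every
`X` ordered by the score. -/
theorem exists_rearranged_density (P : Measure Ω) [IsProbabilityMeasure P] {S : Ω → ℝ}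
    (hS : Measurable S) (hS0 : ∀ c, P {ω | S ω = c} = 0) {Q : Measure Ω}
    [IsProbabilityMeasure Q] (hQ : Q ≪ P) :
    ∃ q' : Ω → ℝ≥0∞, Measurable q' ∧ (∀ ω ω', S ω ≤ S ω' → q' ω' ≤ q' ω) ∧
      P.map q' = P.map (Q.rnDeriv P) ∧ IsProbabilityMeasure (P.withDensity q') ∧
      ∀ X : Ω → ℝ≥0∞, Measurable X → (∀ ω ω', S ω < S ω' → X ω ≤ X ω') →
        ∫⁻ ω, X ω ∂(P.withDensity q') ≤ ∫⁻ ω, X ω ∂Q := by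
  have hq : Measurable (Q.rnDeriv P) := Measure.measurable_rnDeriv Q P
  obtain ⟨q', hq', hanti, hmap⟩ := exists_rearrangement P hS hS0 hq
  refine ⟨q', hq', hanti, hmap, ⟨?_⟩, fun X hX hmono => ?_⟩
  · rw [withDensity_apply _ MeasurableSet.univ, setLIntegral_univ]
    calc ∫⁻ ω, q' ω ∂P = ∫⁻ c, c ∂(P.map q') := (lintegral_map measurable_id hq').symm
      _ = ∫⁻ ω, Q.rnDeriv P ω ∂P := by rw [hmap]; exact lintegral_map measurable_id hq
      _ = 1 := by rw [Measure.lintegral_rnDeriv hQ, measure_univ]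
  · have key := lintegral_mul_le_of_map_eq P hX hq hq' (Measure.rnDeriv_ne_top Q P) hmap hanti hmono
    calc ∫⁻ ω, X ω ∂(P.withDensity q') = ∫⁻ ω, X ω * q' ω ∂P := by
          rw [lintegral_withDensity_eq_lintegral_mul P hq' hX]
          exact lintegral_congr fun ω => mul_comm _ _
      _ ≤ ∫⁻ ω, X ω * Q.rnDeriv P ω ∂P := key
      _ = ∫⁻ ω, X ω ∂(P.withDensity (Q.rnDeriv P)) := by
          rw [lintegral_withDensity_eq_lintegral_mul P hq hX]
          exact lintegral_congr fun ω => mul_comm _ _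
      _ = ∫⁻ ω, X ω ∂Q := by rw [Measure.withDensity_rnDeriv_eq Q P hQ]

/-- Under a product measure the factors are independent, so the law of their product depends only on
the two laws. This makes marginal rearrangements a joint rearrangement. -/
theorem map_mul_prod_eq (μ : Measure Ω) [IsProbabilityMeasure μ] {q₁ q₂ q₁' q₂' : Ω → ℝ≥0∞}
    (h₁ : Measurable q₁) (h₂ : Measurable q₂) (h₁' : Measurable q₁') (h₂' : Measurable q₂')
    (hm₁ : μ.map q₁' = μ.map q₁) (hm₂ : μ.map q₂' = μ.map q₂) :
    (μ.prod μ).map (fun x => q₁' x.1 * q₂' x.2) = (μ.prod μ).map (fun x => q₁ x.1 * q₂ x.2) := by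
  have key : ∀ {a b : Ω → ℝ≥0∞}, Measurable a → Measurable b →
      (μ.prod μ).map (fun x => a x.1 * b x.2)
        = ((μ.map a).prod (μ.map b)).map fun c => c.1 * c.2 := by
    intro a b ha hb
    have hmul : Measurable fun c : ℝ≥0∞ × ℝ≥0∞ => c.1 * c.2 := measurable_fst.mul measurable_snd
    rw [Measure.map_prod_map _ _ ha hb, Measure.map_map hmul (ha.prodMap hb)]
    rfl
  rw [key h₁' h₂', key h₁ h₂, hm₁, hm₂]

end Priors

theorem measure_coe_eq_zero (μ : Measure Typ) [NullSingletonClass μ] (c : ℝ) :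
    μ {θ : Typ | (θ : ℝ) = c} = 0 := by
  have : {θ : Typ | (θ : ℝ) = c}.Subsingleton :=
    fun x (hx : (x : ℝ) = c) y (hy : (y : ℝ) = c) => Subtype.ext (hx.trans hy.symm)
  exact this.measure_zero μ

theorem fst_absolutelyContinuous {Q P : Measure (Typ × Typ)} (h : Q ≪ P) : Q.fst ≪ P.fst :=
  h.map measurable_fst

theorem snd_absolutelyContinuous {Q P : Measure (Typ × Typ)} (h : Q ≪ P) : Q.snd ≪ P.snd :=
  h.map measurable_snd

/-- A rearrangement of a product prior, obtained by rearranging its marginals in decreasing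
order. -/
theorem isRearrangement_prod (μ Q₁ Q₂ : Measure Typ) [IsProbabilityMeasure μ]
    [IsProbabilityMeasure Q₁] [IsProbabilityMeasure Q₂] (h₁ : Q₁ ≪ μ) (h₂ : Q₂ ≪ μ)
    {q₁ q₂ : Typ → ℝ≥0∞} (hq₁ : Measurable q₁) (hq₂ : Measurable q₂)
    (hm₁ : μ.map q₁ = μ.map (Q₁.rnDeriv μ)) (hm₂ : μ.map q₂ = μ.map (Q₂.rnDeriv μ)) :
    IsRearrangement (μ.prod μ) ((μ.withDensity q₁).prod (μ.withDensity q₂)) (Q₁.prod Q₂) := by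
  have hr₁ := Measure.measurable_rnDeriv Q₁ μ
  have hr₂ := Measure.measurable_rnDeriv Q₂ μ
  have hr : Measurable fun x : Typ × Typ => Q₁.rnDeriv μ x.1 * Q₂.rnDeriv μ x.2 :=
    (hr₁.comp measurable_fst).mul (hr₂.comp measurable_snd)
  rw [prod_withDensity hq₁ hq₂]
  refine isRearrangement_withDensity _ hr
    ((hq₁.comp measurable_fst).mul (hq₂.comp measurable_snd)) ?_
    (map_mul_prod_eq μ hr₁ hr₂ hq₁ hq₂ hm₁ hm₂)
  have : Q₁.prod Q₂ = (μ.prod μ).withDensity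
      fun x : Typ × Typ => Q₁.rnDeriv μ x.1 * Q₂.rnDeriv μ x.2 := by
    rw [← prod_withDensity hr₁ hr₂, Measure.withDensity_rnDeriv_eq _ _ h₁,
      Measure.withDensity_rnDeriv_eq _ _ h₂]
  rw [this]
  exact Measure.rnDeriv_withDensity _ hr

theorem antitone_mul_prod {q₁ q₂ : Typ → ℝ≥0∞} (h₁ : Antitone q₁) (h₂ : Antitone q₂) :
    Antitone fun x : Typ × Typ => q₁ x.1 * q₂ x.2 :=
  fun _ _ h => mul_le_mul' (h₁ h.1) (h₂ h.2)

theorem lintegral_prod_le_of_forall_monotone {Q₁ Q₂ Q₁' Q₂' : Measure Typ}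
    [IsProbabilityMeasure Q₁] [IsProbabilityMeasure Q₂] [IsProbabilityMeasure Q₁']
    [IsProbabilityMeasure Q₂']
    (h₁ : ∀ Y : Typ → ℝ≥0∞, Monotone Y → ∫⁻ θ, Y θ ∂Q₁' ≤ ∫⁻ θ, Y θ ∂Q₁)
    (h₂ : ∀ Y : Typ → ℝ≥0∞, Monotone Y → ∫⁻ θ, Y θ ∂Q₂' ≤ ∫⁻ θ, Y θ ∂Q₂)
    {X : Typ × Typ → ℝ≥0∞} (hXm : Measurable X) (hX : Monotone X) :
    ∫⁻ x, X x ∂(Q₁'.prod Q₂') ≤ ∫⁻ x, X x ∂(Q₁.prod Q₂) := by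
  rw [lintegral_prod _ hXm.aemeasurable, lintegral_prod _ hXm.aemeasurable]
  calc ∫⁻ x, ∫⁻ y, X (x, y) ∂Q₂' ∂Q₁' ≤ ∫⁻ x, ∫⁻ y, X (x, y) ∂Q₂ ∂Q₁' :=
        lintegral_mono fun x => h₂ _ fun a b hab => hX ⟨le_rfl, hab⟩
    _ ≤ _ := h₁ _ fun a b hab => lintegral_mono fun y => hX ⟨hab, le_rfl⟩

theorem exists_antitone_density (μ Q₁ : Measure Typ) [IsProbabilityMeasure μ]
    [NullSingletonClass μ] [IsProbabilityMeasure Q₁] (h₁ : Q₁ ≪ μ) :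
    ∃ q' : Typ → ℝ≥0∞, Measurable q' ∧ Antitone q' ∧ μ.map q' = μ.map (Q₁.rnDeriv μ) ∧
      IsProbabilityMeasure (μ.withDensity q') ∧
      ∀ Y : Typ → ℝ≥0∞, Monotone Y → ∫⁻ θ, Y θ ∂(μ.withDensity q') ≤ ∫⁻ θ, Y θ ∂Q₁ := by
  obtain ⟨q', hq', hanti, hmap, hprob, hle⟩ := exists_rearranged_density μ
    (S := fun θ : Typ => (θ : ℝ)) measurable_subtype_coe (measure_coe_eq_zero μ) h₁
  exact ⟨q', hq', fun a b hab => hanti a b hab, hmap, hprob,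
    fun Y hY => hle Y hY.measurable fun a b hab => hY (le_of_lt hab)⟩

/-- Every prior in a rearrangement invariant set can be replaced by one in the set whose density is
decreasing in both types, without raising the expectation of an increasing random variable. -/
theorem exists_antitone_prior (μ : Measure Typ) [IsProbabilityMeasure μ] [NullSingletonClass μ]
    {𝒬 : Set (Measure (Typ × Typ))}
    (h𝒬 : RearrangementInvariant (μ.prod μ) (beliefs (μ.prod μ)) 𝒬 ∨
      RearrangementInvariant (μ.prod μ) (independentBeliefs (μ.prod μ)) 𝒬 ∨
      RearrangementInvariant (μ.prod μ) (iidBeliefs (μ.prod μ)) 𝒬)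
    {X : Typ × Typ → ℝ≥0∞} (hXm : Measurable X) (hX : Monotone X)
    {S : Typ × Typ → ℝ} (hSm : Measurable S) (hS : Monotone S)
    (hS0 : ∀ c, (μ.prod μ) {x | S x = c} = 0) (hXS : ∀ x y, S x < S y → X x ≤ X y)
    {Q : Measure (Typ × Typ)} (hQ : Q ∈ 𝒬) :
    ∃ q : Typ × Typ → ℝ≥0∞, Measurable q ∧ Antitone q ∧ (μ.prod μ).withDensity q ∈ 𝒬 ∧
      ∫⁻ x, X x ∂((μ.prod μ).withDensity q) ≤ ∫⁻ x, X x ∂Q := by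
  have key : Q ∈ beliefs (μ.prod μ) → IsIndependent Q →
      ∃ q₁ q₂ : Typ → ℝ≥0∞, Measurable q₁ ∧ Measurable q₂ ∧ Antitone q₁ ∧ Antitone q₂ ∧
        (μ.prod μ).withDensity (fun x => q₁ x.1 * q₂ x.2) ∈ independentBeliefs (μ.prod μ) ∧
        IsRearrangement (μ.prod μ) ((μ.prod μ).withDensity fun x => q₁ x.1 * q₂ x.2) Q ∧
        ∫⁻ x, X x ∂((μ.prod μ).withDensity fun x => q₁ x.1 * q₂ x.2) ≤ ∫⁻ x, X x ∂Q ∧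
        (IsIID Q → IsIID ((μ.prod μ).withDensity fun x => q₁ x.1 * q₂ x.2)) := by
    rintro ⟨hprob, hac⟩ hind
    have hac₁ : Q.fst ≪ μ := by
      have := fst_absolutelyContinuous hac
      rwa [Measure.fst_prod] at this
    have hac₂ : Q.snd ≪ μ := by
      have := snd_absolutelyContinuous hac
      rwa [Measure.snd_prod] at this
    have build : ∀ q₁ q₂ : Typ → ℝ≥0∞, Measurable q₁ → Measurable q₂ →
        μ.map q₁ = μ.map (Q.fst.rnDeriv μ) → μ.map q₂ = μ.map (Q.snd.rnDeriv μ) →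
        IsProbabilityMeasure (μ.withDensity q₁) → IsProbabilityMeasure (μ.withDensity q₂) →
        (∀ Y : Typ → ℝ≥0∞, Monotone Y → ∫⁻ θ, Y θ ∂(μ.withDensity q₁) ≤ ∫⁻ θ, Y θ ∂Q.fst) →
        (∀ Y : Typ → ℝ≥0∞, Monotone Y → ∫⁻ θ, Y θ ∂(μ.withDensity q₂) ≤ ∫⁻ θ, Y θ ∂Q.snd) →
        (μ.prod μ).withDensity (fun x => q₁ x.1 * q₂ x.2) ∈ independentBeliefs (μ.prod μ) ∧
        IsRearrangement (μ.prod μ) ((μ.prod μ).withDensity fun x => q₁ x.1 * q₂ x.2) Q ∧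
        ∫⁻ x, X x ∂((μ.prod μ).withDensity fun x => q₁ x.1 * q₂ x.2) ≤ ∫⁻ x, X x ∂Q := by
      intro q₁ q₂ hq₁ hq₂ hm₁ hm₂ hp₁ hp₂ hle₁ hle₂
      have hac' : (μ.prod μ).withDensity (fun x => q₁ x.1 * q₂ x.2) ≪ μ.prod μ :=
        withDensity_absolutelyContinuous _ _
      rw [← prod_withDensity hq₁ hq₂] at hac' ⊢
      refine ⟨⟨⟨inferInstance, hac'⟩, ?_⟩, ?_, ?_⟩
      · rw [IsIndependent, Measure.fst_prod, Measure.snd_prod]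
      · rw [hind]
        exact isRearrangement_prod μ Q.fst Q.snd hac₁ hac₂ hq₁ hq₂ hm₁ hm₂
      · conv_rhs => rw [hind]
        exact lintegral_prod_le_of_forall_monotone hle₁ hle₂ hXm hX
    obtain ⟨q₁, hq₁, ha₁, hm₁, hp₁, hle₁⟩ := exists_antitone_density μ Q.fst hac₁
    by_cases heq : Q.fst = Q.snd
    -- Equal marginals must receive the same rearranged density, otherwise the IID property would be
    -- lost.
    · obtain ⟨hb, hr, hle⟩ := build q₁ q₁ hq₁ hq₁ hm₁ (heq ▸ hm₁) hp₁ hp₁ hle₁ (heq ▸ hle₁)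
      refine ⟨q₁, q₁, hq₁, hq₁, ha₁, ha₁, hb, hr, hle, fun _ => ⟨hb.2, ?_⟩⟩
      rw [← prod_withDensity hq₁ hq₁, Measure.fst_prod, Measure.snd_prod]
    · obtain ⟨q₂, hq₂, ha₂, hm₂, hp₂, hle₂⟩ := exists_antitone_density μ Q.snd hac₂
      obtain ⟨hb, hr, hle⟩ := build q₁ q₂ hq₁ hq₂ hm₁ hm₂ hp₁ hp₂ hle₁ hle₂
      exact ⟨q₁, q₂, hq₁, hq₂, ha₁, ha₂, hb, hr, hle, fun h => absurd h.2 heq⟩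
  rcases h𝒬 with ⟨hsub, hinv⟩ | ⟨hsub, hinv⟩ | ⟨hsub, hinv⟩
  -- Only without a product restriction is the joint score `S` used; the other two cases rank each
  -- marginal by its own type.
  · obtain ⟨hprob, hac⟩ := hsub hQ
    obtain ⟨q, hq, hanti, hmap, hprob', hle⟩ := exists_rearranged_density _ hSm hS0 hac
    refine ⟨q, hq, fun a b hab => hanti a b (hS hab), hinv Q hQ _
      ⟨hprob', withDensity_absolutelyContinuous _ _⟩ ?_, hle X hXm hXS⟩
    exact isRearrangement_withDensity _ (Measure.measurable_rnDeriv _ _) hq (ae_eq_refl _) hmap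
  · obtain ⟨hb, hind⟩ := hsub hQ
    obtain ⟨q₁, q₂, hq₁, hq₂, ha₁, ha₂, hb', hr, hle, -⟩ := key hb hind
    exact ⟨_, (hq₁.comp measurable_fst).mul (hq₂.comp measurable_snd), antitone_mul_prod ha₁ ha₂,
      hinv Q hQ _ hb' hr, hle⟩
  · obtain ⟨hb, hiid⟩ := hsub hQ
    obtain ⟨q₁, q₂, hq₁, hq₂, ha₁, ha₂, hb', hr, hle, hiid'⟩ := key hb hiid.1
    exact ⟨_, (hq₁.comp measurable_fst).mul (hq₂.comp measurable_snd), antitone_mul_prod ha₁ ha₂,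
      hinv Q hQ _ ⟨hb'.1, hiid' hiid⟩ hr, hle⟩

/-! ### Scores with a continuous distribution -/

theorem measure_prod_max_eq (μ : Measure Typ) [IsProbabilityMeasure μ] [NullSingletonClass μ]
    (c : ℝ) : (μ.prod μ) {x | ((max x.1 x.2 : Typ) : ℝ) = c} = 0 := by
  have h1 := measure_coe_eq_zero μ c
  refine measure_mono_null (t := {θ : Typ | (θ : ℝ) = c} ×ˢ univ ∪ univ ×ˢ {θ : Typ | (θ : ℝ) = c})
    (fun x hx => ?_) ?_
  · rcases max_choice x.1 x.2 with h | h
    · exact Or.inl ⟨h ▸ hx, trivial⟩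
    · exact Or.inr ⟨trivial, h ▸ hx⟩
  · rw [measure_union_null_iff, Measure.prod_prod, Measure.prod_prod, h1, zero_mul, mul_zero]
    exact ⟨rfl, rfl⟩

theorem measure_prod_min_eq (μ : Measure Typ) [IsProbabilityMeasure μ] [NullSingletonClass μ]
    (c : ℝ) : (μ.prod μ) {x | ((min x.1 x.2 : Typ) : ℝ) = c} = 0 := by
  have h1 := measure_coe_eq_zero μ c
  refine measure_mono_null (t := {θ : Typ | (θ : ℝ) = c} ×ˢ univ ∪ univ ×ˢ {θ : Typ | (θ : ℝ) = c})
    (fun x hx => ?_) ?_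
  · rcases min_choice x.1 x.2 with h | h
    · exact Or.inl ⟨h ▸ hx, trivial⟩
    · exact Or.inr ⟨trivial, h ▸ hx⟩
  · rw [measure_union_null_iff, Measure.prod_prod, Measure.prod_prod, h1, zero_mul, mul_zero]
    exact ⟨rfl, rfl⟩

/-- Strict monotonicity makes each section of a level set at most a single point, which is null. -/
theorem measure_prod_add_eq (μ : Measure Typ) [IsProbabilityMeasure μ] [NullSingletonClass μ]
    {g : Typ → ℝ} (hg : StrictMono g) (c : ℝ) :
    (μ.prod μ) {x | g x.1 + g x.2 = c} = 0 := by
  have hgm : Measurable g := hg.monotone.measurable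
  have hs : MeasurableSet {x : Typ × Typ | g x.1 + g x.2 = c} :=
    measurableSet_eq_fun ((hgm.comp measurable_fst).add (hgm.comp measurable_snd)) measurable_const
  rw [Measure.measure_prod_null hs]
  refine ae_of_all _ fun x => ?_
  have : (Prod.mk x ⁻¹' {x : Typ × Typ | g x.1 + g x.2 = c}).Subsingleton :=
    fun y (hy : g x + g y = c) z (hz : g x + g z = c) => hg.injective (by linarith)
  exact this.measure_zero μ

/-! ### The reference belief -/

theorem isOpenPosMeasure_volume : (volume : Measure Typ).IsOpenPosMeasure := by
  refine ⟨fun U hU hne h0 => ?_⟩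
  obtain ⟨a, b, hab, hsub⟩ := hU.exists_Ioo_subset hne
  have h := measure_mono_null hsub h0
  rw [unitInterval.volume_Ioo, ENNReal.ofReal_eq_zero, sub_nonpos] at h
  exact absurd hab (not_lt.2 h)

/-- A positive density makes Lebesgue measure absolutely continuous with respect to `P`, and this
passes to the first marginals. -/
theorem isOpenPosMeasure_fst {P : Measure (Typ × Typ)} (h : HasPositiveDensity P) :
    P.fst.IsOpenPosMeasure := by
  obtain ⟨p, hp, hpos, rfl⟩ := h
  have hac : (volume : Measure (Typ × Typ)) ≪ volume.withDensity p :=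
    withDensity_absolutelyContinuous' hp.aemeasurable (ae_of_all _ fun x => (hpos x).ne')
  have hfst : (volume : Measure (Typ × Typ)).fst = volume := Measure.fst_prod
  have := fst_absolutelyContinuous hac
  rw [hfst] at this
  have := isOpenPosMeasure_volume
  exact Measure.AbsolutelyContinuous.isOpenPosMeasure ‹_›

theorem nullSingletonClass_fst {P : Measure (Typ × Typ)} {f : Typ → ℝ} (hf : IsMargDensity P f) :
    NullSingletonClass P.fst := by
  rw [hf.fst_eq]
  exact ⟨fun x => withDensity_absolutelyContinuous _ _ (measure_singleton x)⟩

/-! ### Payments and revenues -/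

section Payments

variable (P : Measure (Typ × Typ)) (f : Typ → ℝ)

theorem measurable_winner {b d : Typ × Typ → ℝ≥0∞} (hb : Measurable b) (hd : Measurable d) :
    Measurable fun x : Typ × Typ => if x.2 < x.1 then b x else if x.1 = x.2 then d x else 0 :=
  Measurable.ite (measurableSet_lt (α := Typ) measurable_snd measurable_fst) hb
    (Measurable.ite (measurableSet_eq_fun measurable_fst measurable_snd) hd measurable_const)

theorem measurable_transferII (i : Fin 2) : Measurable (Function.uncurry (transferII i)) :=
  measurable_winner (measurable_ofReal_coe.comp measurable_snd)
    ((measurable_ofReal_coe.comp measurable_snd).div_const 2)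

theorem revenue_transferII (x : Typ × Typ) :
    revenue (transferII 0) x = ENNReal.ofReal (min x.1 x.2 : Typ) := by
  simp only [revenue, transferII, bidII]
  rcases lt_trichotomy x.1 x.2 with h | h | h
  · simp [h, h.not_gt, h.ne, min_eq_left h.le]
  · simp [h, ENNReal.add_halves]
  · simp [h, h.not_gt, h.ne, min_eq_right h.le]

theorem measurable_transferI {μ : Measure Typ} [IsProbabilityMeasure μ]
    (hI : ∀ θ, bidI P θ = meanBelow μ θ) (i : Fin 2) :
    Measurable (Function.uncurry (transferI P i)) := by
  have hm : Measurable (bidI P) := by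
    rw [funext hI]; exact (meanBelow_monotone μ).measurable
  exact measurable_winner (hm.comp measurable_fst) ((hm.comp measurable_fst).div_const 2)

theorem revenue_transferI (x : Typ × Typ) :
    revenue (transferI P 0) x = bidI P (max x.1 x.2) := by
  simp only [revenue, transferI]
  rcases lt_trichotomy x.1 x.2 with h | h | h
  · simp [h, h.not_gt, h.ne, max_eq_right h.le]
  · simp [h, ENNReal.add_halves]
  · simp [h, h.not_gt, h.ne, max_eq_left h.le]

theorem transferW_eq {W : Typ → ℝ≥0∞} (hW : ∀ θ, bidW P f θ = W θ) (i : Fin 2) (θ θ' : Typ) :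
    transferW P f i θ θ' = W (min θ θ') := by
  simp only [transferW, hW]
  split_ifs with h
  · rw [min_eq_right h.le]
  · rw [min_eq_left (not_lt.1 h)]

end Payments

/-- The better auction under any prior earns at least what it earns under an antitone rearrangement
in `𝒬`, where the worse auction earns no more. Only `T'` has to be monotone and ordered by the
score. -/
theorem worstCaseRevenue_le_of_forall_antitone (μ : Measure Typ) [IsProbabilityMeasure μ]
    [NullSingletonClass μ] {𝒬 : Set (Measure (Typ × Typ))}
    (h𝒬 : RearrangementInvariant (μ.prod μ) (beliefs (μ.prod μ)) 𝒬 ∨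
      RearrangementInvariant (μ.prod μ) (independentBeliefs (μ.prod μ)) 𝒬 ∨
      RearrangementInvariant (μ.prod μ) (iidBeliefs (μ.prod μ)) 𝒬)
    {t t' : Transfer} {T T' : Typ → Typ → ℝ≥0∞} (ht : ∀ i, t i = T) (ht' : ∀ i, t' i = T')
    (hTm : Measurable (revenue T)) (hTm' : Measurable (revenue T')) (hT' : Monotone (revenue T'))
    {S : Typ × Typ → ℝ} (hSm : Measurable S) (hS : Monotone S)
    (hS0 : ∀ c, (μ.prod μ) {x | S x = c} = 0)
    (hTS : ∀ x y, S x < S y → revenue T' x ≤ revenue T' y)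
    (h : ∀ q : Typ × Typ → ℝ≥0∞, Measurable q → Antitone q →
      ∫⁻ x, q x * revenue T x ∂(μ.prod μ) ≤ ∫⁻ x, q x * revenue T' x ∂(μ.prod μ)) :
    worstCaseRevenue 𝒬 t ≤ worstCaseRevenue 𝒬 t' := by
  refine le_iInf₂ fun Q hQ => ?_
  obtain ⟨q, hq, hqa, hmem, hle⟩ := exists_antitone_prior μ h𝒬 hTm' hT' hSm hS hS0 hTS hQ
  refine (iInf₂_le _ hmem).trans ?_
  have e : ∀ Q', expectedRevenue Q' t = ∫⁻ x, revenue T x ∂Q' := fun Q' => by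
    simp only [expectedRevenue, ht, revenue]
  have e' : ∀ Q', expectedRevenue Q' t' = ∫⁻ x, revenue T' x ∂Q' := fun Q' => by
    simp only [expectedRevenue, ht', revenue]
  rw [e, e']
  refine le_trans ?_ hle
  rw [lintegral_withDensity_eq_lintegral_mul _ hq hTm,
    lintegral_withDensity_eq_lintegral_mul _ hq hTm']
  exact h q hq hqa

end

end WorstCaseAuction

/-! ### The four revenue comparisons -/

open WorstCaseAuction

theorem theorem3
    (P : MeasureTheory.Measure (WorstCaseAuction.Typ × WorstCaseAuction.Typ))
    [MeasureTheory.IsProbabilityMeasure P]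
    (hpos : WorstCaseAuction.HasPositiveDensity P)
    (hiid : WorstCaseAuction.IsIID P)
    (f : WorstCaseAuction.Typ → ℝ)
    (hf : WorstCaseAuction.IsMargDensity P f)
    (𝒬 : Set (MeasureTheory.Measure (WorstCaseAuction.Typ × WorstCaseAuction.Typ)))
    (hP : P ∈ 𝒬)
    (h𝒬 : WorstCaseAuction.RearrangementInvariant P (WorstCaseAuction.beliefs P) 𝒬 ∨
      WorstCaseAuction.RearrangementInvariant P (WorstCaseAuction.independentBeliefs P) 𝒬 ∨
      WorstCaseAuction.RearrangementInvariant P (WorstCaseAuction.iidBeliefs P) 𝒬) :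
    (WorstCaseAuction.worstCaseRevenue 𝒬 WorstCaseAuction.transferII ≤
        WorstCaseAuction.worstCaseRevenue 𝒬 (WorstCaseAuction.transferI P)) ∧
    (WorstCaseAuction.worstCaseRevenue 𝒬 (WorstCaseAuction.transferA P) ≤
        WorstCaseAuction.worstCaseRevenue 𝒬 (WorstCaseAuction.transferI P)) ∧
    (WorstCaseAuction.worstCaseRevenue 𝒬 (WorstCaseAuction.transferW P f) ≤
        WorstCaseAuction.worstCaseRevenue 𝒬 (WorstCaseAuction.transferA P)) ∧
    (MonotoneOn (fun θ : WorstCaseAuction.Typ =>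
          (θ : ℝ) * f θ / (1 - WorstCaseAuction.margCDF P θ)) (Set.Iio 1) →
      WorstCaseAuction.worstCaseRevenue 𝒬 (WorstCaseAuction.transferW P f) ≤
        WorstCaseAuction.worstCaseRevenue 𝒬 WorstCaseAuction.transferII) := by
  obtain ⟨μ, hμ⟩ : ∃ μ, P.fst = μ := ⟨_, rfl⟩
  have hprob : IsProbabilityMeasure μ := hμ ▸ inferInstance
  have hopen : μ.IsOpenPosMeasure := hμ ▸ isOpenPosMeasure_fst hpos
  have hnull : NullSingletonClass μ := hμ ▸ nullSingletonClass_fst hf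
  have hPμ : P = μ.prod μ := by
    have h := hiid.1
    rwa [IsIndependent, ← hiid.2, hμ] at h
  have hI : ∀ θ, bidI P θ = meanBelow μ θ := bidI_eq μ hμ
  have hA : ∀ θ, bidA P θ = lowerMoment μ θ := bidA_eq μ hμ
  have hW : ∀ θ, bidW P f θ = attritionBid μ θ := bidW_eq μ hμ hf
  rw [hPμ] at h𝒬
  have hTI := measurable_transferI P hI 0
  have hTII := measurable_transferII 0
  have hTA : Measurable (Function.uncurry (transferA P 0)) := by
    have : Function.uncurry (transferA P 0) = fun x => lowerMoment μ x.1 := funext fun x => hA x.1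
    rw [this]
    exact (lowerMoment_monotone μ).measurable.comp measurable_fst
  have hTW : Measurable (Function.uncurry (transferW P f 0)) := by
    have : Function.uncurry (transferW P f 0) = fun x => attritionBid μ (min x.1 x.2) :=
      funext fun x => transferW_eq P f hW 0 x.1 x.2
    rw [this]
    exact (attritionBid_monotone μ).measurable.comp (measurable_fst.min measurable_snd)
  have hrev : ∀ {T : Typ → Typ → ENNReal}, Measurable (Function.uncurry T) →
      Measurable (revenue T) := fun hT => hT.add (hT.comp measurable_swap)
  have hmax : Monotone fun x : Typ × Typ => max x.1 x.2 := fun _ _ h => max_le_max h.1 h.2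
  have hmin : Monotone fun x : Typ × Typ => min x.1 x.2 := fun _ _ h => min_le_min h.1 h.2
  have hRI : ∀ x, revenue (transferI P 0) x = meanBelow μ (max x.1 x.2) := fun x => by
    rw [revenue_transferI, hI]
  have hRA : ∀ x, revenue (transferA P 0) x = lowerMoment μ x.1 + lowerMoment μ x.2 := fun x => by
    simp only [revenue, transferA, hA]
  have hRW : ∀ x, revenue (transferW P f 0) x = 2 * attritionBid μ (min x.1 x.2) := fun x => by
    rw [revenue, transferW_eq P f hW, transferW_eq P f hW, min_comm x.2, two_mul]
  have versusI : ∀ {t : Transfer} {T : Typ → Typ → ENNReal}, (∀ i, t i = T) →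
      Measurable (Function.uncurry T) →
      (∀ q : Typ → ENNReal, Measurable q → Antitone q → ∀ θ,
        ∫⁻ θ', q θ' * T θ θ' ∂μ ≤ ∫⁻ θ', q θ' * transferI P 0 θ θ' ∂μ) →
      worstCaseRevenue 𝒬 t ≤ worstCaseRevenue 𝒬 (transferI P) := by
    intro t T ht hT h
    -- First-price revenue depends only on the higher type, so the maximum is the score.
    refine worstCaseRevenue_le_of_forall_antitone μ h𝒬 (T' := transferI P 0) ht (fun _ => rfl) (hrev hT) (hrev hTI)
      (fun x y hxy => ?_) (S := fun x => ((max x.1 x.2 : Typ) : ℝ))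
      (measurable_subtype_coe.comp (measurable_fst.max measurable_snd)) (fun x y hxy => hmax hxy)
      (measure_prod_max_eq μ) (fun x y hxy => ?_)
      (fun q hqm hq => lintegral_mul_revenue_le μ hT hTI h hqm hq)
    · rw [hRI, hRI]; exact meanBelow_monotone μ (hmax hxy)
    · rw [hRI, hRI]; exact meanBelow_monotone μ (le_of_lt hxy)
  refine ⟨versusI (T := transferII 0) (fun _ => rfl) hTII fun q hqm hq θ => ?_,
    versusI (T := transferA P 0) (fun _ => rfl) hTA fun q hqm hq θ => ?_, ?_, fun hmono => ?_⟩
  · simp only [transferII, transferI]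
    rw [lintegral_mul_winner, lintegral_mul_winner, hI]
    exact setLIntegral_mul_type_le μ hqm hq θ
  · simp only [transferA, transferI]
    rw [lintegral_mul_winner, hI, hA]
    exact lintegral_mul_lowerMoment_le μ hqm hq θ
  -- All-pay revenue is finite and serves as its own score; strict monotonicity of the bid makes its
  -- level sets null.
  · have hg : StrictMono fun θ => (lowerMoment μ θ).toReal := fun a b hab =>
      (ENNReal.toReal_lt_toReal (lowerMoment_ne_top μ a) (lowerMoment_ne_top μ b)).2
        (lowerMoment_strictMono μ hab)
    have hgm : Measurable fun θ => (lowerMoment μ θ).toReal := hg.monotone.measurable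
    refine worstCaseRevenue_le_of_forall_antitone μ h𝒬 (T := transferW P f 0)
      (T' := transferA P 0) (fun _ => rfl) (fun _ => rfl) (hrev hTW) (hrev hTA) (fun x y hxy => ?_)
      (S := fun x => (lowerMoment μ x.1).toReal + (lowerMoment μ x.2).toReal)
      ((hgm.comp measurable_fst).add (hgm.comp measurable_snd))
      (fun x y hxy => add_le_add (hg.monotone hxy.1) (hg.monotone hxy.2))
      (measure_prod_add_eq μ hg) (fun x y hxy => ?_)
      (fun q hqm hq => lintegral_mul_revenue_le μ hTW hTA (fun q hqm hq θ => ?_) hqm hq)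
    · rw [hRA, hRA]
      exact add_le_add (lowerMoment_monotone μ hxy.1) (lowerMoment_monotone μ hxy.2)
    · rw [hRA, hRA, ← ENNReal.toReal_le_toReal
        (ENNReal.add_ne_top.2 ⟨lowerMoment_ne_top μ _, lowerMoment_ne_top μ _⟩)
        (ENNReal.add_ne_top.2 ⟨lowerMoment_ne_top μ _, lowerMoment_ne_top μ _⟩),
        ENNReal.toReal_add (lowerMoment_ne_top μ _) (lowerMoment_ne_top μ _),
        ENNReal.toReal_add (lowerMoment_ne_top μ _) (lowerMoment_ne_top μ _)]
      exact hxy.le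
    · simp only [transferW_eq P f hW, transferA, hA]
      exact lintegral_mul_attritionBid_le μ hqm hq θ
  · refine worstCaseRevenue_le_of_forall_antitone μ h𝒬 (T := transferW P f 0)
      (T' := transferII 0) (fun _ => rfl) (fun _ => rfl) (hrev hTW) (hrev hTII) (fun x y hxy => ?_) (S := fun x => ((min x.1 x.2 : Typ) : ℝ))
      (measurable_subtype_coe.comp (measurable_fst.min measurable_snd)) (fun x y hxy => hmin hxy)
      (measure_prod_min_eq μ) (fun x y hxy => ?_) (fun q hqm hq => ?_)
    · rw [revenue_transferII, revenue_transferII]; exact monotone_ofReal_coe (hmin hxy)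
    · rw [revenue_transferII, revenue_transferII]; exact monotone_ofReal_coe (le_of_lt hxy)
    · simp_rw [hRW, revenue_transferII]
      -- Both revenues are functions of the lower type: `h` is twice the war-of-attrition bid and
      -- `k` the type itself.
      refine lintegral_mul_min_le_of_crossing μ (h := fun θ => 2 * attritionBid μ θ)
        ((attritionBid_monotone μ).measurable.const_mul 2) measurable_ofReal_coe
        (fun x y hxy hy hlt => ?_) ?_ (lintegral_two_mul_attritionBid μ).le hqm hq
      · rw [← hW] at hlt ⊢
        exact ofReal_le_two_mul_bidW_of_lt P f hmono hxy hy hlt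
      · rw [← lintegral_lowerMoment]
        refine ne_top_of_le_ne_top ENNReal.one_ne_top ?_
        calc ∫⁻ θ, lowerMoment μ θ ∂μ ≤ ∫⁻ _, 1 ∂μ :=
              lintegral_mono fun θ => (lowerMoment_le_measure μ θ).trans prob_le_one
          _ = 1 := by simp
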